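/- Let $P\ge 1$ agents be given with combination matrices $A_0,A_1,A_2\in\mathbb{R}^{P\times P}$, $A_j=[a_{j,mp}]$, that are left-stochastic ($a_{j,mp}\ge 0$, $\sum_m a_{j,mp}=1$ for every $p$), such that $A_1A_0A_2$ is primitive, and let $q$ be its Perron vector: $A_1A_0A_2\,q=q$, $q_p>0$, $\sum_p q_p=1$. Agent $p$ has the empirical risk $J_p(w)=\frac1{N_p}\sum_{n=1}^{N_p}Q_p(w;x_{p,n})$ on $\mathbb{R}^M$, $w^o$ is the minimizer of $\frac1P\sum_pJ_p$ and $w_p^o$ that of $J_p$. Assume that, for some $\nu,\delta>0$ and $\xi\ge0$, the risks $J_p$ are $\nu$-strongly convex, the losses $Q_p(\cdot;x_{p,n})$ are convex and twice differentiable with $\delta$-Lipschitz gradients, and $\|w^o-w^o_p\|\le\xi$ for all $p$. For a step-size $\mu>0$ and $i\ge1$ consider the privatized algorithm $$\phi_{p,i-1}=\sum_m a_{1,mp}(w_{m,i-1}+g_{1,mp,i}),\qquad \psi_{p,i}=\sum_m a_{0,mp}(\phi_{m,i-1}+g_{0,mp,i})-\mu\,\widehat{\nabla J_p}(\phi_{p,i-1}),\qquad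 w_{p,i}=\sum_m a_{2,mp}(\psi_{m,i}+g_{2,mp,i}),$$ started from random $w_{p,0}$ with finite second moments. Let $\mathcal F_{i-1}$ be the $\sigma$-algebra generated by $\{w_{p,j}\}_{p,\,j\le i-1}$. The gradient noise $s_{p,i}=\widehat{\nabla J_p}(\phi_{p,i-1})-\nabla J_p(\phi_{p,i-1})$ is square integrable with $\mathbb{E}[s_{p,i}\mid\mathcal F_{i-1}]=0$ and $\mathbb{E}[\|s_{p,i}\|^2\mid\mathcal F_{i-1}]\le\beta_{s,p}^2\,\mathbb{E}[\|w^o-\phi_{p,i-1}\|^2\mid\mathcal F_{i-1}]+\sigma_{s,p}^2$. The added noises are $g_{j,mp,i}=c_{j,mp}\,g_{j,m,i}$, where the noise $g_{j,m,i}$ drawn by agent $m$ (for instance Laplacian, independent of the past) is square integrable with $\mathbb{E}[g_{j,m,i}\mid\mathcal F_{i-1}]=0$ and every coordinate of variance at most $\sigma_g^2$, and where the fixed coefficients $c_{j,mp}$ are graph-homomorphic: for each $j$, either $c_{j,pm}=a_{j,pm}/a_{j,mp}$ for $m\ne p$ and $c_{j,pp}=-(1-a_{j,pp})/a_{j,pp}$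 (quotients with zero denominator being read as $0$), or $\sum_{p,m}q_p\,a_{j,mp}\,g_{j,mp,i}=0$ almost surely for all $i$. Let $w_{c,i}=\sum_p q_pw_{p,i}$ be the network centroid. Then there are $\mu_0>0$ and $C_1,C_2\ge0$ that depend only on $M$, $P$, $A_0,A_1,A_2$, $q$, $c$, $\nu$, $\delta$, $\xi$ and $\beta_{s,p},\sigma_{s,p}$ (not on the risks, the step-size, $\sigma_g$, the noises or the initial models) such that, for every $0<\mu<\mu_0$, all $w_{p,i}-w_{c,i}$ are square integrable, the network disagreement is bounded uniformly in $i$, $$\sup_{i\ge0}\ \frac1P\sum_{p=1}^P\mathbb{E}\|w_{p,i}-w_{c,i}\|^2<\infty ,$$ and $$\limsup_{i\to\infty}\ \frac1P\sum_{p=1}^P\mathbb{E}\|w_{p,i}-w_{c,i}\|^2\ \le\ C_1\,\sigma_g^2+C_2\,\mu .$$ -/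

import Mathlib

open MeasureTheory ProbabilityTheory Filter Topology

noncomputable section

/-- The model space `ℝ^M` with its Euclidean norm. -/
abbrev Model (M : ℕ) : Type := EuclideanSpace ℝ (Fin M)

/-- The empirical risk `J(w) = (1/N) ∑ₙ Q(w; xₙ)` of one agent. -/
def risk {M N : ℕ} {X : Type*} (Q : Model M → X → ℝ) (x : Fin N → X) (w : Model M) : ℝ :=
  (1 / (N : ℝ)) * ∑ n, Q w (x n)

/-- The aggregate risk `(1/P) ∑ₚ Jₚ(w)`. -/
def aggregateRisk {M P : ℕ} {X : Type*} {N : Fin P → ℕ} (Q : Fin P → Model M → X → ℝ)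
    (x : (p : Fin P) → Fin (N p) → X) (w : Model M) : ℝ :=
  (1 / (P : ℝ)) * ∑ p, risk (Q p) (x p) w

/-- Convexity and smoothness: the risks are `ν`-strongly convex; the losses are convex, twice
differentiable, with `δ`-Lipschitz gradients (at the data points of the agents). -/
structure ConvexSmooth {M P : ℕ} {X : Type*} {N : Fin P → ℕ} (ν δ : ℝ)
    (Q : Fin P → Model M → X → ℝ) (x : (p : Fin P) → Fin (N p) → X) : Prop where
  data_pos : ∀ p, 0 < N p
  diff : ∀ p n, Differentiable ℝ (fun w => Q p w (x p n))
  twice_diff : ∀ p n, Differentiable ℝ (gradient (fun w => Q p w (x p n)))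
  strongly_convex : ∀ p (w₁ w₂ : Model M),
    risk (Q p) (x p) w₁ + inner ℝ (gradient (risk (Q p) (x p)) w₁) (w₂ - w₁)
      + ν / 2 * ‖w₂ - w₁‖ ^ 2 ≤ risk (Q p) (x p) w₂
  convex : ∀ p n (w₁ w₂ : Model M),
    Q p w₁ (x p n) + inner ℝ (gradient (fun w => Q p w (x p n)) w₁) (w₂ - w₁)
      ≤ Q p w₂ (x p n)
  lipschitz_grad : ∀ p n (w₁ w₂ : Model M),
    ‖gradient (fun w => Q p w (x p n)) w₂ - gradient (fun w => Q p w (x p n)) w₁‖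
      ≤ δ * ‖w₂ - w₁‖

/-- Model drifts: `wo` minimizes the aggregate risk, and each agent's risk has a minimizer at
distance at most `ξ` from `wo`. -/
structure ModelDrift {M P : ℕ} {X : Type*} {N : Fin P → ℕ} (ξ : ℝ)
    (Q : Fin P → Model M → X → ℝ) (x : (p : Fin P) → Fin (N p) → X) (wo : Model M) : Prop where
  isMin : ∀ w, aggregateRisk Q x wo ≤ aggregateRisk Q x w
  drift : ∀ p, ∃ wop : Model M,
    (∀ w, risk (Q p) (x p) wop ≤ risk (Q p) (x p) w) ∧ ‖wo - wop‖ ≤ ξ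

/-- `q` is the Perron vector of `A`: positive entries adding up to one, and `A q = q`. -/
structure IsPerronVector {P : ℕ} (A : Matrix (Fin P) (Fin P) ℝ) (q : Fin P → ℝ) : Prop where
  pos : ∀ p, 0 < q p
  sum_eq_one : ∑ p, q p = 1
  eigen : A.mulVec q = q

/-- The graph-homomorphic coefficients: agent `p` sends to agent `m` its message perturbed by
`ghpCoeff a p m` times the noise drawn by agent `p`. -/
def ghpCoeff {P : ℕ} (a : Matrix (Fin P) (Fin P) ℝ) (p m : Fin P) : ℝ :=
  if m = p then -((1 - a p p) / a p p) else a p m / a m p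

/-- The noise `g_{j,mp,i} = c_{j,mp} g_{j,m,i}` added to the message from agent `m` to agent `p`,
built from the noise `g_{j,m,i}` drawn by agent `m`. -/
def edgeNoise {M P : ℕ} {Ω : Type*} (c : Fin 3 → Fin P → Fin P → ℝ)
    (g : Fin 3 → Fin P → ℕ → Ω → Model M) (j : Fin 3) (m p : Fin P) (i : ℕ) (ω : Ω) : Model M :=
  c j m p • g j m i ω

/-- The σ-algebra generated by the models `w_{p,j}` of all agents at the times `j ≤ i`. -/
@[reducible] def pastModels {M P : ℕ} {Ω : Type*} (w : Fin P → ℕ → Ω → Model M) (i : ℕ) :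
    MeasurableSpace Ω :=
  ⨆ (j : ℕ) (_ : j ≤ i) (p : Fin P), MeasurableSpace.comap (w p j) inferInstance

/-- The network centroid `w_{c,i} = ∑ₚ qₚ w_{p,i}`. -/
def centroid {M P : ℕ} {Ω : Type*} (q : Fin P → ℝ) (w : Fin P → ℕ → Ω → Model M)
    (i : ℕ) (ω : Ω) : Model M :=
  ∑ p, q p • w p i ω

/-- The network disagreement `(1/P) ∑ₚ E‖w_{p,i} - w_{c,i}‖²`. -/
def disagreement {M P : ℕ} {Ω : Type*} [MeasurableSpace Ω] (Pr : Measure Ω) (q : Fin P → ℝ)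
    (w : Fin P → ℕ → Ω → Model M) (i : ℕ) : ℝ :=
  (1 / (P : ℝ)) * ∑ p, ∫ ω, ‖w p i ω - centroid q w i ω‖ ^ 2 ∂Pr

/-- A run of the privatized distributed learning algorithm with step-size `μ`, combination
matrices `A 0`, `A 1`, `A 2` (`A j m p` is the weight that agent `p` gives to what comes from
agent `m`), risks `J p`, stochastic gradients `G p i` (the approximation of
`∇ Jₚ (φ_{p,i-1})` used in iteration `i`), noises `g j p i` drawn by agent `p` for step `j` of
iteration `i`, and noise coefficients `c`. Iterations are numbered `1, 2, …`; iteration `i + 1`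
leads from `w p i` to `w p (i + 1)`. -/
structure IsPrivatizedRun {M P : ℕ} {Ω : Type*} [MeasurableSpace Ω] (Pr : Measure Ω)
    (A : Fin 3 → Matrix (Fin P) (Fin P) ℝ) (q : Fin P → ℝ) (c : Fin 3 → Fin P → Fin P → ℝ)
    (J : Fin P → Model M → ℝ) (wo : Model M) (β σs : Fin P → ℝ) (μ σg : ℝ)
    (g : Fin 3 → Fin P → ℕ → Ω → Model M) (G : Fin P → ℕ → Ω → Model M)
    (φ ψ w : Fin P → ℕ → Ω → Model M) : Prop where
  /-- the initial models have finite second moments -/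
  init_measurable : ∀ p, Measurable (w p 0)
  init_memLp : ∀ p, MemLp (w p 0) 2 Pr
  /-- the three steps of iteration `i + 1` -/
  pre_combine : ∀ p i ω, φ p i ω =
    ∑ m, A 1 m p • (w m i ω + edgeNoise c g 1 m p (i + 1) ω)
  update : ∀ p i ω, ψ p (i + 1) ω =
    ∑ m, A 0 m p • (φ m i ω + edgeNoise c g 0 m p (i + 1) ω) - μ • G p (i + 1) ω
  post_combine : ∀ p i ω, w p (i + 1) ω =
    ∑ m, A 2 m p • (ψ m (i + 1) ω + edgeNoise c g 2 m p (i + 1) ω)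
  /-- the drawn noises: zero mean given the past models (which holds if they are centred and
  independent of the past), variance of every coordinate at most `σg ^ 2` -/
  noise_measurable : ∀ j p i, Measurable (g j p (i + 1))
  noise_memLp : ∀ j p i, MemLp (g j p (i + 1)) 2 Pr
  noise_mean : ∀ j p i, Pr[g j p (i + 1) | pastModels w i] =ᵐ[Pr] 0
  noise_variance : ∀ j p i k, ∫ ω, (g j p (i + 1) ω k) ^ 2 ∂Pr ≤ σg ^ 2
  /-- the perturbations are graph-homomorphic: in each of the three steps they are given by the
  explicit construction, or else cancel out over the network -/
  homomorphic : ∀ j, c j = ghpCoeff (A j) ∨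
    ∀ i, ∀ᵐ ω ∂Pr, ∑ p, ∑ m, (q p * A j m p) • edgeNoise c g j m p (i + 1) ω = 0
  /-- the gradient noise `G p (i + 1) - ∇ Jₚ (φ p i)`: zero mean and bounded second moment given
  the past models -/
  grad_measurable : ∀ p i, Measurable (G p (i + 1))
  gradNoise_memLp : ∀ p i, MemLp (fun ω => G p (i + 1) ω - gradient (J p) (φ p i ω)) 2 Pr
  gradNoise_mean : ∀ p i,
    Pr[fun ω => G p (i + 1) ω - gradient (J p) (φ p i ω) | pastModels w i] =ᵐ[Pr] 0
  gradNoise_variance : ∀ p i,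
    Pr[fun ω => ‖G p (i + 1) ω - gradient (J p) (φ p i ω)‖ ^ 2 | pastModels w i] ≤ᵐ[Pr]
      fun ω => β p ^ 2 * (Pr[fun ω' => ‖wo - φ p i ω'‖ ^ 2 | pastModels w i]) ω + σs p ^ 2

end

/-!
The run is split, at every time, into the error of the centroid `x = w_c - wo` and the deviations
`y_p = w_p - w_c` of the agents from it. Write `T = A 1 * A 0 * A 2`.

* The deviations obey `y' = mix T y + e`, where `e` collects the drawn noises and `μ` times the
  stochastic gradients. Since `T` is primitive, a power of `T` contracts the network vectors of
  weighted sum zero in the norm weighted by `q`. Summing this norm along the first powers gives a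
  quadratic form `lyapunov` that contracts in every single step (`exists_lyapunov_contraction`).
  With `D` its expectation, `D' ≤ (1 - r) D + O(σg² + μ² (1 + V + D))`, where `V = E‖x‖²`.
* The centroid takes a stochastic gradient step for a convex combination of the risks. Strong
  convexity contracts it by `1 - ν μ`; the gradients are evaluated at points that differ from the
  centroid by deviations and noises, and the zero conditional means remove the terms linear in the
  noises. So `V' ≤ (1 - ν μ) V + O(μ (1 + D) + σg² + μ² V)`.

The centroid error is only of order `σg² / μ + 1`, because combining the noises of the inner steps
need not preserve their cancellation. This is harmless: in the recursion for `D` it comes with the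
factor `μ²`, so that `D` is eventually of order `σg² + μ` (`coupled_recursion_bound`). The
pointwise part of the two recursions, with all constants, is `exists_iteration_bounds`.
-/

/-! ### Network vectors and combination matrices -/

section Norms

variable {ι E : Type*} [Fintype ι] [NormedAddCommGroup E]

/-- The squared norm `∑ₚ ‖yₚ‖²` of a network vector. -/
def sqNorm (y : ι → E) : ℝ := ∑ p, ‖y p‖ ^ 2

/-- The squared norm `∑ₚ qₚ ‖yₚ‖²` weighted by `q`. -/
def wSqNorm (q : ι → ℝ) (y : ι → E) : ℝ := ∑ p, q p * ‖y p‖ ^ 2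

lemma sqNorm_nonneg (y : ι → E) : 0 ≤ sqNorm y := by unfold sqNorm; positivity

lemma norm_sq_le_sqNorm (y : ι → E) (p : ι) : ‖y p‖ ^ 2 ≤ sqNorm y :=
  Finset.single_le_sum (f := fun p => ‖y p‖ ^ 2) (fun _ _ => by positivity) (Finset.mem_univ p)

lemma wSqNorm_nonneg {q : ι → ℝ} (hq : ∀ p, 0 ≤ q p) (y : ι → E) : 0 ≤ wSqNorm q y :=
  Finset.sum_nonneg fun p _ => mul_nonneg (hq p) (by positivity)

lemma wSqNorm_add_le {q : ι → ℝ} (hq : ∀ p, 0 ≤ q p) {ε : ℝ} (hε : 0 < ε) (y z : ι → E) :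
    wSqNorm q (y + z) ≤ (1 + ε) * wSqNorm q y + (1 + 1 / ε) * wSqNorm q z := by
  simp only [wSqNorm, Finset.mul_sum, ← Finset.sum_add_distrib]
  refine Finset.sum_le_sum fun p _ => ?_
  have h1 : ‖y p + z p‖ ^ 2 ≤ (1 + ε) * ‖y p‖ ^ 2 + (1 + 1 / ε) * ‖z p‖ ^ 2 := by
    have h2 : ‖y p + z p‖ ^ 2 ≤ (‖y p‖ + ‖z p‖) ^ 2 := by gcongr; exact norm_add_le _ _
    have h3 : (1 + ε) * ‖y p‖ ^ 2 + (1 + 1 / ε) * ‖z p‖ ^ 2 - (‖y p‖ + ‖z p‖) ^ 2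
        = (ε * ‖y p‖ - ‖z p‖) ^ 2 / ε := by field_simp; ring
    have h4 : 0 ≤ (ε * ‖y p‖ - ‖z p‖) ^ 2 / ε := by positivity
    linarith
  calc q p * ‖(y + z) p‖ ^ 2 ≤ q p * ((1 + ε) * ‖y p‖ ^ 2 + (1 + 1 / ε) * ‖z p‖ ^ 2) :=
        mul_le_mul_of_nonneg_left h1 (hq p)
    _ = _ := by ring

lemma wSqNorm_le_sqNorm {q : ι → ℝ} (hq : ∀ p, 0 ≤ q p) (y : ι → E) :
    wSqNorm q y ≤ (∑ p, q p) * sqNorm y := by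
  rw [Finset.sum_mul]
  exact Finset.sum_le_sum fun p _ => mul_le_mul_of_nonneg_left (norm_sq_le_sqNorm y p) (hq p)

lemma sqNorm_le_wSqNorm {q : ι → ℝ} (hq : ∀ p, 0 < q p) (y : ι → E) :
    sqNorm y ≤ (∑ p, 1 / q p) * wSqNorm q y := by
  rw [Finset.sum_mul]
  refine Finset.sum_le_sum fun p _ => ?_
  have h1 : q p * ‖y p‖ ^ 2 ≤ wSqNorm q y :=
    Finset.single_le_sum (f := fun p => q p * ‖y p‖ ^ 2)
      (fun r _ => mul_nonneg (hq r).le (by positivity)) (Finset.mem_univ p)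
  have h2 := hq p
  calc ‖y p‖ ^ 2 = 1 / q p * (q p * ‖y p‖ ^ 2) := by field_simp
    _ ≤ _ := mul_le_mul_of_nonneg_left h1 (by positivity)

lemma sqNorm_add_le (y z : ι → E) : sqNorm (y + z) ≤ 2 * sqNorm y + 2 * sqNorm z := by
  simp only [sqNorm, Finset.mul_sum, ← Finset.sum_add_distrib]
  refine Finset.sum_le_sum fun p _ => ?_
  have h2 : ‖y p + z p‖ ^ 2 ≤ (‖y p‖ + ‖z p‖) ^ 2 := by gcongr; exact norm_add_le _ _
  simp only [Pi.add_apply]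
  nlinarith [sq_nonneg (‖y p‖ - ‖z p‖)]

lemma sqNorm_const (v : E) : sqNorm (fun _ : ι => v) = Fintype.card ι * ‖v‖ ^ 2 := by
  simp [sqNorm]

end Norms

section Mixing

variable {ι E : Type*} [Fintype ι] [NormedAddCommGroup E] [NormedSpace ℝ E]

/-- One combination step over the network: agent `p` receives `∑ₘ T m p • y m`. -/
def mix (T : Matrix ι ι ℝ) (y : ι → E) (p : ι) : E := ∑ m, T m p • y m

/-- The weighted sum `∑ₚ qₚ • yₚ` of a network vector. -/
def wsum (q : ι → ℝ) (y : ι → E) : E := ∑ p, q p • y p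

lemma mix_add (T : Matrix ι ι ℝ) (y z : ι → E) : mix T (y + z) = mix T y + mix T z := by
  funext p; simp [mix, Finset.sum_add_distrib]

lemma mix_sub (T : Matrix ι ι ℝ) (y z : ι → E) : mix T (y - z) = mix T y - mix T z := by
  funext p; simp [mix, smul_sub, Finset.sum_sub_distrib]

lemma mix_smul (T : Matrix ι ι ℝ) (a : ℝ) (y : ι → E) : mix T (a • y) = a • mix T y := by
  funext p; simp [mix, Finset.smul_sum, smul_comm a]

lemma mix_mix (S T : Matrix ι ι ℝ) (y : ι → E) : mix T (mix S y) = mix (S * T) y := by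
  funext p
  simp only [mix, Matrix.mul_apply, Finset.smul_sum, Finset.sum_smul, smul_smul]
  rw [Finset.sum_comm]
  simp [mul_comm]

lemma mix_one [DecidableEq ι] (y : ι → E) : mix (1 : Matrix ι ι ℝ) y = y := by
  funext p; simp [mix, Matrix.one_apply]

lemma mix_const [DecidableEq ι] {T : Matrix ι ι ℝ} (hT : T ∈ Matrix.colStochastic ℝ ι) (v : E) :
    mix T (fun _ => v) = fun _ => v := by
  funext p
  simp [mix, ← Finset.sum_smul, Matrix.sum_col_of_mem_colStochastic hT]

lemma wsum_add (q : ι → ℝ) (y z : ι → E) : wsum q (y + z) = wsum q y + wsum q z := by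
  simp [wsum, Finset.sum_add_distrib]

lemma wsum_sub (q : ι → ℝ) (y z : ι → E) : wsum q (y - z) = wsum q y - wsum q z := by
  simp [wsum, smul_sub, Finset.sum_sub_distrib]

lemma wsum_smul (q : ι → ℝ) (a : ℝ) (y : ι → E) : wsum q (a • y) = a • wsum q y := by
  simp [wsum, Finset.smul_sum, smul_comm a]

lemma wsum_const {q : ι → ℝ} (hq : ∑ p, q p = 1) (v : E) : wsum q (fun _ => v) = v := by
  simp [wsum, ← Finset.sum_smul, hq]

lemma wsum_mix (q : ι → ℝ) (T : Matrix ι ι ℝ) (y : ι → E) :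
    wsum q (mix T y) = wsum (T.mulVec q) y := by
  simp only [wsum, mix, Matrix.mulVec, dotProduct, Finset.smul_sum, Finset.sum_smul, smul_smul]
  rw [Finset.sum_comm]
  simp [mul_comm]

lemma norm_wsum_sq_le (q : ι → ℝ) (y : ι → E) : ‖wsum q y‖ ^ 2 ≤ (∑ p, q p ^ 2) * sqNorm y := by
  have h1 : ‖wsum q y‖ ≤ ∑ p, |q p| * ‖y p‖ :=
    (norm_sum_le _ _).trans (le_of_eq (by simp [norm_smul]))
  calc ‖wsum q y‖ ^ 2 ≤ (∑ p, |q p| * ‖y p‖) ^ 2 := by gcongr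
    _ ≤ (∑ p, |q p| ^ 2) * ∑ p, ‖y p‖ ^ 2 := Finset.sum_mul_sq_le_sq_mul_sq _ _ _
    _ = _ := by simp [sqNorm]

lemma sqNorm_mix_le (T : Matrix ι ι ℝ) (y : ι → E) :
    sqNorm (mix T y) ≤ (∑ p, ∑ m, T m p ^ 2) * sqNorm y := by
  rw [Finset.sum_mul]
  exact Finset.sum_le_sum fun p _ => norm_wsum_sq_le (fun m => T m p) y

/-- Jensen's inequality for the squared norm, with nonnegative weights of any total mass. -/
lemma norm_wsum_sq_le_of_nonneg {a : ι → ℝ} (ha : ∀ p, 0 ≤ a p) (y : ι → E) :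
    ‖wsum a y‖ ^ 2 ≤ (∑ p, a p) * wSqNorm a y := by
  have h1 : ‖wsum a y‖ ≤ ∑ p, a p * ‖y p‖ := by
    refine (norm_sum_le _ _).trans (le_of_eq (Finset.sum_congr rfl fun p _ => ?_))
    rw [norm_smul, Real.norm_of_nonneg (ha p)]
  calc ‖wsum a y‖ ^ 2 ≤ (∑ p, a p * ‖y p‖) ^ 2 := by gcongr
    _ ≤ (∑ p, a p) * ∑ p, a p * ‖y p‖ ^ 2 :=
      Finset.sum_sq_le_sum_mul_sum_of_sq_le_mul _ (fun p _ => ha p)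
        (fun p _ => mul_nonneg (ha p) (by positivity)) (fun p _ => le_of_eq (by ring))
    _ = _ := rfl

/-- A nonnegative matrix with column sums `s` and `R q = s q` contracts the norm weighted by `q`
by the factor `s`. -/
lemma wSqNorm_mix_le {q : ι → ℝ} (hq : ∀ p, 0 ≤ q p) {R : Matrix ι ι ℝ} {s : ℝ}
    (hR : ∀ m p, 0 ≤ R m p) (hcol : ∀ p, ∑ m, R m p = s) (heig : R.mulVec q = s • q)
    (y : ι → E) : wSqNorm q (mix R y) ≤ s ^ 2 * wSqNorm q y := by
  have h1 : ∀ p, ‖mix R y p‖ ^ 2 ≤ s * ∑ m, R m p * ‖y m‖ ^ 2 := fun p =>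
    (norm_wsum_sq_le_of_nonneg (fun m => hR m p) y).trans (le_of_eq (by rw [hcol]; rfl))
  have h2 : ∀ m, ∑ p, q p * R m p = s * q m := fun m => by
    have := congrFun heig m
    simp only [Matrix.mulVec, dotProduct, Pi.smul_apply, smul_eq_mul] at this
    rw [← this]
    exact Finset.sum_congr rfl fun p _ => mul_comm _ _
  calc wSqNorm q (mix R y) ≤ ∑ p, q p * (s * ∑ m, R m p * ‖y m‖ ^ 2) :=
        Finset.sum_le_sum fun p _ => mul_le_mul_of_nonneg_left (h1 p) (hq p)
    _ = s * ∑ m, (∑ p, q p * R m p) * ‖y m‖ ^ 2 := by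
        simp only [Finset.mul_sum, Finset.sum_mul]
        rw [Finset.sum_comm]
        exact Finset.sum_congr rfl fun m _ => Finset.sum_congr rfl fun p _ => by ring
    _ = s ^ 2 * wSqNorm q y := by
        simp only [h2, wSqNorm, Finset.mul_sum]
        exact Finset.sum_congr rfl fun m _ => by ring

lemma sqNorm_smul (a : ℝ) (y : ι → E) : sqNorm (a • y) = a ^ 2 * sqNorm y := by
  simp [sqNorm, norm_smul, mul_pow, Finset.mul_sum]

lemma sqNorm_sub_le (y z : ι → E) : sqNorm (y - z) ≤ 2 * sqNorm y + 2 * sqNorm z := by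
  have h := sqNorm_add_le y ((-1 : ℝ) • z)
  rw [sqNorm_smul] at h
  simpa [sub_eq_add_neg] using h

end Mixing

/-! ### A quadratic form contracted by a primitive combination matrix -/

section Contraction

variable {ι E : Type*} [Fintype ι] [DecidableEq ι] [NormedAddCommGroup E] [NormedSpace ℝ E]

lemma pow_mulVec_eq {T : Matrix ι ι ℝ} {q : ι → ℝ} (h : T.mulVec q = q) (k : ℕ) :
    (T ^ k).mulVec q = q := by
  induction k with
  | zero => simp
  | succ k ih => rw [pow_succ, ← Matrix.mulVec_mulVec, h, ih]

/-- The quadratic form `∑_{j < k} ∑ₚ qₚ ‖(Tʲ y)ₚ‖²`. It telescopes along `y ↦ mix T y`, which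
makes a contraction in `k` steps a contraction in one step. -/
def lyapunov (q : ι → ℝ) (T : Matrix ι ι ℝ) (k : ℕ) (y : ι → E) : ℝ :=
  ∑ j ∈ Finset.range k, wSqNorm q (mix (T ^ j) y)

/-- A positive column-stochastic matrix dominates a multiple of `q 1ᵀ`, which acts as zero on the
vectors of weighted sum zero; what is left contracts. -/
lemma exists_wSqNorm_contraction {q : ι → ℝ} (hq : ∀ p, 0 < q p) (hq1 : ∑ p, q p = 1)
    {S : Matrix ι ι ℝ} (hS : S ∈ Matrix.colStochastic ℝ ι) (hSq : S.mulVec q = q)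
    (hpos : ∀ m p, 0 < S m p) :
    ∃ η : ℝ, 0 ≤ η ∧ η < 1 ∧ ∀ y : ι → E, wsum q y = 0 →
      wSqNorm q (mix S y) ≤ η * wSqNorm q y := by
  obtain ⟨ε, hε0, hε1, hε⟩ : ∃ ε : ℝ, 0 < ε ∧ ε ≤ 1 ∧ ∀ m p, ε ≤ S m p := by
    rcases isEmpty_or_nonempty ι with hι | hι
    · exact ⟨1, one_pos, le_rfl, fun m => hι.elim m⟩
    · obtain ⟨⟨m₀, p₀⟩, h⟩ := Finite.exists_min fun z : ι × ι => S z.1 z.2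
      exact ⟨S m₀ p₀, hpos _ _, Matrix.le_one_of_mem_colStochastic hS, fun m p => h (m, p)⟩
  have hqle : ∀ m, q m ≤ 1 := fun m => by
    rw [← hq1]
    exact Finset.single_le_sum (fun p _ => (hq p).le) (Finset.mem_univ m)
  set R : Matrix ι ι ℝ := Matrix.of fun m p => S m p - ε * q m with hR
  refine ⟨(1 - ε) ^ 2, by positivity, by nlinarith, fun y hy => ?_⟩
  have hmix : mix S y = mix R y := by
    funext p
    have h1 : ∑ m, (ε * q m) • y m = 0 := by
      simp only [mul_smul, ← Finset.smul_sum]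
      have : ∑ m, q m • y m = 0 := hy
      rw [this, smul_zero]
    simp [mix, hR, sub_smul, Finset.sum_sub_distrib, h1]
  rw [hmix]
  refine wSqNorm_mix_le (fun p => (hq p).le) (fun m p => ?_) (fun p => ?_) ?_ y
  · have := mul_le_mul_of_nonneg_left (hqle m) hε0.le
    have := hε m p
    simp only [hR, Matrix.of_apply]
    linarith
  · simp [hR, Finset.sum_sub_distrib, Matrix.sum_col_of_mem_colStochastic hS, ← Finset.mul_sum, hq1]
  · funext m
    have := congrFun hSq m
    simp only [Matrix.mulVec, dotProduct] at this
    simp only [hR, Matrix.mulVec, dotProduct, Matrix.of_apply, sub_mul, Finset.sum_sub_distrib,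
      this, ← Finset.mul_sum, hq1, Pi.smul_apply, smul_eq_mul]
    ring

lemma lyapunov_nonneg {q : ι → ℝ} (hq : ∀ p, 0 ≤ q p) (T : Matrix ι ι ℝ) (k : ℕ) (y : ι → E) :
    0 ≤ lyapunov q T k y :=
  Finset.sum_nonneg fun _ _ => wSqNorm_nonneg hq _

lemma wSqNorm_le_lyapunov {q : ι → ℝ} (hq : ∀ p, 0 ≤ q p) (T : Matrix ι ι ℝ) {k : ℕ} (hk : 0 < k)
    (y : ι → E) : wSqNorm q y ≤ lyapunov q T k y := by
  have := Finset.single_le_sum (f := fun j => wSqNorm q (mix (T ^ j) y))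
    (fun _ _ => wSqNorm_nonneg hq _) (Finset.mem_range.2 hk)
  simpa [mix_one, lyapunov] using this

lemma lyapunov_le_wSqNorm {q : ι → ℝ} (hq : ∀ p, 0 ≤ q p) {T : Matrix ι ι ℝ}
    (hT : T ∈ Matrix.colStochastic ℝ ι) (hTq : T.mulVec q = q) (k : ℕ) (y : ι → E) :
    lyapunov q T k y ≤ k * wSqNorm q y := by
  have h : ∀ j ∈ Finset.range k, wSqNorm q (mix (T ^ j) y) ≤ wSqNorm q y := fun j _ => by
    have hj : T ^ j ∈ Matrix.colStochastic ℝ ι := pow_mem hT j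
    have := wSqNorm_mix_le (s := 1) hq (fun m p => Matrix.nonneg_of_mem_colStochastic hj)
      (fun p => Matrix.sum_col_of_mem_colStochastic hj p) (by simp [pow_mulVec_eq hTq]) y
    simpa using this
  simpa [lyapunov] using Finset.sum_le_card_nsmul _ _ _ h

lemma lyapunov_add_le {q : ι → ℝ} (hq : ∀ p, 0 ≤ q p) (T : Matrix ι ι ℝ) (k : ℕ) {ε : ℝ}
    (hε : 0 < ε) (y z : ι → E) :
    lyapunov q T k (y + z) ≤ (1 + ε) * lyapunov q T k y + (1 + 1 / ε) * lyapunov q T k z := by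
  simp only [lyapunov, Finset.mul_sum, ← Finset.sum_add_distrib, mix_add]
  exact Finset.sum_le_sum fun j _ => wSqNorm_add_le hq hε _ _

/-- For a primitive combination matrix, some `lyapunov` form contracts in every step on the
vectors of weighted sum zero. -/
lemma exists_lyapunov_contraction {q : ι → ℝ} (hq : ∀ p, 0 < q p) (hq1 : ∑ p, q p = 1)
    {T : Matrix ι ι ℝ} (hT : T ∈ Matrix.colStochastic ℝ ι) (hTq : T.mulVec q = q)
    (hprim : T.IsPrimitive) :
    ∃ (k : ℕ) (r : ℝ), 0 < k ∧ 0 < r ∧ r ≤ 1 ∧ ∀ y : ι → E, wsum q y = 0 →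
      lyapunov q T k (mix T y) ≤ (1 - r) * lyapunov q T k y := by
  obtain ⟨k, hk, hpos⟩ := hprim.exists_pos_pow
  obtain ⟨η, hη0, hη1, hη⟩ := exists_wSqNorm_contraction (E := E) hq hq1 (pow_mem hT k)
    (pow_mulVec_eq hTq k) hpos
  have hk' : (1 : ℝ) ≤ k := by exact_mod_cast hk
  refine ⟨k, (1 - η) / k, hk, by apply div_pos <;> linarith,
    (div_le_one (by linarith)).2 (by linarith), fun y hy => ?_⟩
  -- the shift `j ↦ j + 1` changes only the two end terms of the sum
  have htel : lyapunov q T k (mix T y) = lyapunov q T k y + wSqNorm q (mix (T ^ k) y)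
      - wSqNorm q y := by
    have h1 : lyapunov q T k (mix T y) = ∑ j ∈ Finset.range k, wSqNorm q (mix (T ^ (j + 1)) y) :=
      Finset.sum_congr rfl fun j _ => by rw [mix_mix, pow_succ']
    have h2 := Finset.sum_range_succ' (fun j => wSqNorm q (mix (T ^ j) y)) k
    have h3 := Finset.sum_range_succ (fun j => wSqNorm q (mix (T ^ j) y)) k
    simp only [pow_zero, mix_one] at h2
    rw [h1, lyapunov]
    linarith
  have h1 := hη y hy
  have h2 := lyapunov_le_wSqNorm (fun p => (hq p).le) hT hTq k y
  have h3 : (1 - η) / k * lyapunov q T k y ≤ (1 - η) * wSqNorm q y := by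
    rw [div_mul_eq_mul_div, div_le_iff₀ (by linarith)]
    nlinarith
  rw [htel]
  linarith

end Contraction

/-! ### Two coupled linear recursions -/

/-- The coupled recursion behind the theorem, for the centroid error `V` and the disagreement `D`.
The sequences are compared with a constant supersolution `(d, v)` plus a geometric mode; there
`v` is of order `1 + s / μ`, but `V` enters the recursion for `D` with the factor `μ ^ 2`. -/
lemma coupled_recursion_bound {a b r : ℝ} (ha : 0 < a) (hb : 0 < b) (hr : 0 < r) (hr1 : r ≤ 1) :
    ∃ μ₀ C₁ C₂ : ℝ, 0 < μ₀ ∧ 0 ≤ C₁ ∧ 0 ≤ C₂ ∧ ∀ (μ s : ℝ) (V D : ℕ → ℝ),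
      0 < μ → μ < μ₀ → 0 ≤ s →
      (∀ i, V (i + 1) ≤ (1 - a * μ) * V i + b * μ * D i + b * μ + b * s) →
      (∀ i, D (i + 1) ≤ (1 - r) * D i + b * μ ^ 2 * V i + b * μ ^ 2 + b * s) →
      ∃ K θ : ℝ, 0 ≤ K ∧ 0 ≤ θ ∧ θ < 1 ∧ ∀ i, D i ≤ C₁ * s + C₂ * μ + K * θ ^ i := by
  -- `t` is the weight of `D` in the geometric mode, whose rate is `1 - a μ / 2`
  set t : ℝ := a / (2 * b) with ht
  have ht0 : 0 < t := by positivity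
  have hbt : b * t = a / 2 := by rw [ht]; field_simp
  refine ⟨min 1 (min (1 / a) (min (r * a / (2 * b ^ 2)) (r * t / (b + a / 2 * t)))),
    2 / r * (b ^ 2 / a + b), 2 / r * (b ^ 2 / a + b), by positivity, by positivity, by positivity,
    fun μ s V D hμ hμ0 hs hV hD => ?_⟩
  obtain ⟨hμ1, hμ2⟩ := lt_min_iff.1 hμ0
  obtain ⟨hμ2, hμ3⟩ := lt_min_iff.1 hμ2
  obtain ⟨hμ3, hμ4⟩ := lt_min_iff.1 hμ3
  rw [lt_div_iff₀ (by positivity)] at hμ2 hμ3 hμ4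
  have hμμ : μ ^ 2 ≤ μ := by nlinarith
  have hbb : b * μ ^ 2 + a / 2 * μ * t ≤ r * t := by
    have := mul_le_mul_of_nonneg_left hμμ hb.le
    linarith
  set d : ℝ := 2 / r * (b ^ 2 / a + b) * s + 2 / r * (b ^ 2 / a + b) * μ with hd
  have hd0 : 0 ≤ d := by positivity
  -- `v` solves the first equation of the fixed point exactly, `d` satisfies the second one as an
  -- inequality: the part `b ^ 2 μ ^ 2 / a * d` fed back through `v` is at most `r / 2 * d`
  set v : ℝ := (b * d + b + b * s / μ) / a with hv
  have hv1 : (1 - a * μ) * v + b * μ * d + b * μ + b * s = v := by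
    rw [hv]; field_simp; ring
  have hd1 : (1 - r) * d + b * μ ^ 2 * v + b * μ ^ 2 + b * s ≤ d := by
    have e1 : b * μ ^ 2 * v
        = (b ^ 2 * μ ^ 2 / a) * d + (b ^ 2 / a) * μ ^ 2 + (b ^ 2 / a) * (μ * s) := by
      rw [hv]; field_simp
    have e2 : r / 2 * d = (b ^ 2 / a + b) * s + (b ^ 2 / a + b) * μ := by
      rw [hd]; field_simp
    have e3 : b ^ 2 * μ ^ 2 / a ≤ r / 2 := by
      rw [div_le_iff₀ ha]
      have := mul_le_mul_of_nonneg_left hμμ (sq_nonneg b)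
      linarith
    have e4 := mul_le_mul_of_nonneg_right e3 hd0
    have e6 : μ * s ≤ s := mul_le_of_le_one_left hs hμ1.le
    have e7 : 0 < b ^ 2 / a := by positivity
    linarith [mul_le_mul_of_nonneg_left hμμ e7.le, mul_le_mul_of_nonneg_left e6 e7.le,
      mul_le_mul_of_nonneg_left hμμ hb.le]
  set θ : ℝ := 1 - a / 2 * μ with hθ
  have haμ : 0 < a * μ := mul_pos ha hμ
  have hθ0 : 0 ≤ θ := by linarith
  have hθ1 : θ < 1 := by linarith
  set K : ℝ := max 0 (max (V 0 - v) ((D 0 - d) / t)) with hK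
  have hK0 : 0 ≤ K := le_max_left _ _
  clear_value t d v
  have key : ∀ i, V i ≤ v + K * θ ^ i ∧ D i ≤ d + t * (K * θ ^ i) := by
    intro i
    induction i with
    | zero =>
      have h1 : V 0 - v ≤ K := (le_max_left _ _).trans (le_max_right _ _)
      have h2 : (D 0 - d) / t ≤ K := (le_max_right _ _).trans (le_max_right _ _)
      rw [div_le_iff₀ ht0] at h2
      constructor <;> simp <;> linarith
    | succ i ih =>
      obtain ⟨h1, h2⟩ := ih
      set g := K * θ ^ i with hg
      have hg0 : 0 ≤ g := by positivity
      have hgs : K * θ ^ (i + 1) = θ * g := by rw [hg]; ring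
      rw [hgs]
      constructor
      · have e1 := mul_le_mul_of_nonneg_left h1 (show 0 ≤ 1 - a * μ by linarith)
        have e2 := mul_le_mul_of_nonneg_left h2 (show 0 ≤ b * μ by positivity)
        have e3 : b * μ * (t * g) = a / 2 * μ * g := by
          rw [← hbt]; ring
        have := hV i
        rw [hθ]
        linarith
      · have e1 := mul_le_mul_of_nonneg_left h1 (show 0 ≤ b * μ ^ 2 by positivity)
        have e2 := mul_le_mul_of_nonneg_left h2 (show 0 ≤ 1 - r by linarith)
        have e4 := mul_le_mul_of_nonneg_right hbb hg0
        have := hD i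
        rw [hθ]
        linarith
  refine ⟨t * K, θ, by positivity, hθ0, hθ1, fun i => ?_⟩
  have := (key i).2
  rw [hd] at this
  linarith

/-- `coupled_recursion_bound` with all the terms of second order in `μ`; for small `μ` they are
absorbed. -/
lemma coupled_recursion_bound_second_order {ν κ r : ℝ} (hν : 0 < ν) (hκ : 0 < κ) (hr : 0 < r)
    (hr1 : r ≤ 1) :
    ∃ μ₀ C₁ C₂ : ℝ, 0 < μ₀ ∧ 0 ≤ C₁ ∧ 0 ≤ C₂ ∧ ∀ (μ s : ℝ) (V D : ℕ → ℝ),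
      0 < μ → μ < μ₀ → 0 ≤ s → (∀ i, 0 ≤ V i) → (∀ i, 0 ≤ D i) →
      (∀ i, V (i + 1) ≤ (1 - ν * μ) * V i + κ * μ * (1 + D i + s) + κ * s
        + κ * μ ^ 2 * (1 + V i + D i + s)) →
      (∀ i, D (i + 1) ≤ (1 - r) * D i + κ * s + κ * μ ^ 2 * (1 + V i + D i + s)) →
      ∃ K θ : ℝ, 0 ≤ K ∧ 0 ≤ θ ∧ θ < 1 ∧ ∀ i, D i ≤ C₁ * s + C₂ * μ + K * θ ^ i := by
  obtain ⟨μ₀, C₁, C₂, hμ₀, hC₁, hC₂, h⟩ := coupled_recursion_bound (a := ν / 2) (b := 3 * κ)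
    (r := r / 2) (by positivity) (by positivity) (by positivity) (by linarith)
  refine ⟨min μ₀ (min 1 (min (ν / (2 * κ)) (r / (2 * κ)))), C₁, C₂, by positivity, hC₁, hC₂,
    fun μ s V D hμ hμ1 hs hV0 hD0 hV hD => ?_⟩
  obtain ⟨hμ1, hμ2⟩ := lt_min_iff.1 hμ1
  obtain ⟨hμ2, hμ3⟩ := lt_min_iff.1 hμ2
  obtain ⟨hμ3, hμ4⟩ := lt_min_iff.1 hμ3
  rw [lt_div_iff₀ (by positivity)] at hμ3 hμ4
  have hμμ : μ ^ 2 ≤ μ := by nlinarith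
  have hκs : κ * μ * s ≤ κ * s :=
    mul_le_mul_of_nonneg_right (mul_le_of_le_one_right hκ.le hμ2.le) hs
  have hκμ : κ * μ ^ 2 ≤ κ * μ := mul_le_mul_of_nonneg_left hμμ hκ.le
  refine h μ s V D hμ hμ1 hs (fun i => ?_) (fun i => ?_)
  · have e1 : κ * μ ^ 2 * V i ≤ ν / 2 * μ * V i := by
      refine mul_le_mul_of_nonneg_right ?_ (hV0 i)
      have := mul_le_mul_of_nonneg_right hμ3.le hμ.le
      linarith
    have e2 := mul_le_mul_of_nonneg_right hκμ (hD0 i)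
    have e3 := mul_le_mul_of_nonneg_right hκμ hs
    have e4 : 0 ≤ κ * μ * D i := mul_nonneg (by positivity) (hD0 i)
    have e5 : 0 ≤ κ * μ := by positivity
    linarith [hV i]
  · have e1 : κ * μ ^ 2 * D i ≤ r / 2 * D i := by
      refine mul_le_mul_of_nonneg_right ?_ (hD0 i)
      linarith
    have e2 := mul_le_mul_of_nonneg_right hκμ hs
    have e3 : 0 ≤ κ * μ ^ 2 * V i := mul_nonneg (by positivity) (hV0 i)
    have e4 : 0 ≤ κ * s := by positivity
    have e5 : 0 ≤ κ * μ ^ 2 := by positivity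
    linarith [hD i]

/-! ### The centroid and the deviations in one iteration -/

section Step

variable {ι E : Type*} [Fintype ι] [NormedAddCommGroup E] [InnerProductSpace ℝ E]

/-- The conditions on the gradient `F` of one agent's risk, with the origin moved to the minimizer
of the aggregate risk: `ν`-strong monotonicity and `δ`-Lipschitz continuity, and a value at the
origin that is at most `δ ξ` because the agent's own minimizer is within `ξ`. -/
structure IsDriftingGradient (ν δ ξ : ℝ) (F : E → E) : Prop where
  norm_zero_le : ‖F 0‖ ≤ δ * ξ
  lipschitz : ∀ a b, ‖F a - F b‖ ≤ δ * ‖a - b‖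
  monotone : ∀ a, ν * ‖a‖ ^ 2 ≤ inner ℝ a (F a - F 0)

variable {ν δ ξ : ℝ}

lemma IsDriftingGradient.norm_sq_le {F : E → E} (hF : IsDriftingGradient ν δ ξ F) (x z : E) :
    ‖F (x + z)‖ ^ 2 ≤ 3 * δ ^ 2 * (ξ ^ 2 + ‖x‖ ^ 2 + ‖z‖ ^ 2) := by
  have h1 : ‖F (x + z)‖ ≤ δ * ξ + δ * ‖x + z‖ := by
    have h2 := hF.lipschitz (x + z) 0
    rw [sub_zero] at h2
    have h3 := norm_add_le (F (x + z) - F 0) (F 0)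
    rw [sub_add_cancel] at h3
    linarith [hF.norm_zero_le]
  have h2 : ‖F (x + z)‖ ^ 2 ≤ (δ * ξ + δ * ‖x + z‖) ^ 2 := by gcongr
  have h3 : ‖x + z‖ ^ 2 ≤ (‖x‖ + ‖z‖) ^ 2 := by gcongr; exact norm_add_le _ _
  have h4 : (δ * ξ + δ * ‖x + z‖) ^ 2 ≤ δ ^ 2 * (3 * ξ ^ 2 + 3 / 2 * ‖x + z‖ ^ 2) := by
    nlinarith [mul_nonneg (sq_nonneg δ) (sq_nonneg (2 * ξ - ‖x + z‖))]
  have h5 : 3 / 2 * ‖x + z‖ ^ 2 ≤ 3 * ‖x‖ ^ 2 + 3 * ‖z‖ ^ 2 := by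
    nlinarith [sq_nonneg (‖x‖ - ‖z‖)]
  nlinarith [mul_le_mul_of_nonneg_left h5 (sq_nonneg δ)]

/-- The gradient taken at a point `x + z` still pulls `x` towards the origin, up to the drift and
the deviation `z`. -/
lemma IsDriftingGradient.inner_ge (hν : 0 < ν) {F : E → E} (hF : IsDriftingGradient ν δ ξ F)
    (x z : E) :
    ν / 2 * ‖x‖ ^ 2 - δ ^ 2 / ν * (ξ ^ 2 + ‖z‖ ^ 2) ≤ inner ℝ x (F (x + z)) := by
  have h1 := hF.monotone x
  have h2 := abs_le.1 (abs_real_inner_le_norm x (F (x + z) - F x))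
  have h3 := abs_le.1 (abs_real_inner_le_norm x (F 0))
  have h4 : ‖F (x + z) - F x‖ ≤ δ * ‖z‖ := by simpa using hF.lipschitz (x + z) x
  have h5 : inner ℝ x (F (x + z)) = inner ℝ x (F x - F 0) + inner ℝ x (F (x + z) - F x)
      + inner ℝ x (F 0) := by
    simp only [inner_sub_right]; ring
  have h6 := mul_le_mul_of_nonneg_left h4 (norm_nonneg x)
  have h7 := mul_le_mul_of_nonneg_left hF.norm_zero_le (norm_nonneg x)
  -- Young's inequality for the two error terms
  have young : ∀ t : ℝ, ‖x‖ * (δ * t) ≤ ν / 4 * ‖x‖ ^ 2 + δ ^ 2 / ν * t ^ 2 := fun t => by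
    have e : ν / 4 * ‖x‖ ^ 2 + δ ^ 2 / ν * t ^ 2 - ‖x‖ * (δ * t)
        = (ν / 2 * ‖x‖ - δ * t) ^ 2 / ν := by field_simp; ring
    have : 0 ≤ (ν / 2 * ‖x‖ - δ * t) ^ 2 / ν := by positivity
    linarith
  have y1 := young ‖z‖
  have y2 := young ξ
  linarith [h2.1, h3.1]

lemma sqNorm_gradient_le {F : ι → E → E} (hF : ∀ m, IsDriftingGradient ν δ ξ (F m)) (x : E)
    (z : ι → E) :
    sqNorm (fun m => F m (x + z m))
      ≤ 3 * δ ^ 2 * (Fintype.card ι * (ξ ^ 2 + ‖x‖ ^ 2) + sqNorm z) := by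
  have h := Finset.sum_le_sum fun m (_ : m ∈ Finset.univ) => (hF m).norm_sq_le x (z m)
  refine h.trans (le_of_eq ?_)
  rw [← Finset.mul_sum, Finset.sum_add_distrib, Finset.sum_const, Finset.card_univ, nsmul_eq_mul]
  rfl

lemma inner_wsum_gradient_ge (hν : 0 < ν) {F : ι → E → E}
    (hF : ∀ m, IsDriftingGradient ν δ ξ (F m)) {π : ι → ℝ} (hπ : ∀ m, 0 ≤ π m)
    (hπ1 : ∑ m, π m = 1) (x : E) (z : ι → E) :
    ν / 2 * ‖x‖ ^ 2 - δ ^ 2 / ν * (ξ ^ 2 + sqNorm z)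
      ≤ inner ℝ x (wsum π fun m => F m (x + z m)) := by
  have h1 : ∀ m, ν / 2 * ‖x‖ ^ 2 - δ ^ 2 / ν * (ξ ^ 2 + sqNorm z) ≤ inner ℝ x (F m (x + z m)) := by
    intro m
    refine le_trans ?_ ((hF m).inner_ge hν x (z m))
    gcongr
    exact norm_sq_le_sqNorm z m
  calc _ = ∑ m, π m * (ν / 2 * ‖x‖ ^ 2 - δ ^ 2 / ν * (ξ ^ 2 + sqNorm z)) := by
        rw [← Finset.sum_mul, hπ1, one_mul]
    _ ≤ ∑ m, π m * inner ℝ x (F m (x + z m)) :=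
        Finset.sum_le_sum fun m _ => mul_le_mul_of_nonneg_left (h1 m) (hπ m)
    _ = _ := by simp [wsum, inner_sum, inner_smul_right]

/-- One step of the centroid. The second term on the right is the one that a zero conditional mean
removes. -/
lemma centroid_step (hν : 0 < ν) {F : ι → E → E} (hF : ∀ m, IsDriftingGradient ν δ ξ (F m))
    {π : ι → ℝ} (hπ : ∀ m, 0 ≤ π m) (hπ1 : ∑ m, π m = 1) (q : ι → ℝ) {μ : ℝ} (hμ : 0 ≤ μ)
    (x : E) (z n s : ι → E) :
    ‖x + wsum q n - μ • wsum π ((fun m => F m (x + z m)) + s)‖ ^ 2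
      ≤ (1 - ν * μ) * ‖x‖ ^ 2 + 2 * inner ℝ x (wsum q n - μ • wsum π s)
        + 2 * μ * (δ ^ 2 / ν * (ξ ^ 2 + sqNorm z)) + 2 * (∑ p, q p ^ 2) * sqNorm n
        + 4 * μ ^ 2 * (∑ p, π p ^ 2) * (sqNorm (fun m => F m (x + z m)) + sqNorm s) := by
  set u : ι → E := fun m => F m (x + z m)
  have h1 := mul_le_mul_of_nonneg_left (inner_wsum_gradient_ge hν hF hπ hπ1 x z) hμ
  have h2 : ‖x + wsum q n - μ • wsum π (u + s)‖ ^ 2 = ‖x‖ ^ 2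
      + 2 * inner ℝ x (wsum q n - μ • wsum π s) - 2 * (μ * inner ℝ x (wsum π u))
      + ‖wsum q n - μ • wsum π (u + s)‖ ^ 2 := by
    rw [add_sub_assoc, norm_add_sq_real]
    simp only [wsum_add, inner_sub_right, inner_smul_right, inner_add_right]
    ring
  have h3 : ‖wsum q n - μ • wsum π (u + s)‖ ^ 2
      ≤ 2 * ‖wsum q n‖ ^ 2 + 2 * (μ ^ 2 * ‖wsum π (u + s)‖ ^ 2) := by
    have h4 : ‖wsum q n - μ • wsum π (u + s)‖ ^ 2 ≤ (‖wsum q n‖ + ‖μ • wsum π (u + s)‖) ^ 2 := by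
      gcongr; exact norm_sub_le _ _
    have h5 : ‖μ • wsum π (u + s)‖ ^ 2 = μ ^ 2 * ‖wsum π (u + s)‖ ^ 2 := by
      rw [norm_smul, mul_pow]; simp
    rw [← h5]
    linarith [sq_nonneg (‖wsum q n‖ - ‖μ • wsum π (u + s)‖)]
  have h4 := norm_wsum_sq_le q n
  have h5 : ‖wsum π (u + s)‖ ^ 2 ≤ (∑ p, π p ^ 2) * (2 * sqNorm u + 2 * sqNorm s) :=
    (norm_wsum_sq_le π (u + s)).trans
      (mul_le_mul_of_nonneg_left (sqNorm_add_le u s) (by positivity))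
  have h6 := mul_le_mul_of_nonneg_left h5 (sq_nonneg μ)
  linarith

/-- The deviation of a network vector from its weighted sum. -/
def deviation (q : ι → ℝ) (y : ι → E) : ι → E := y - fun _ => wsum q y

lemma wsum_deviation {q : ι → ℝ} (hq1 : ∑ p, q p = 1) (y : ι → E) :
    wsum q (deviation q y) = 0 := by
  rw [deviation, wsum_sub, wsum_const hq1, sub_self]

lemma deviation_add (q : ι → ℝ) (y z : ι → E) :
    deviation q (y + z) = deviation q y + deviation q z := by
  funext p
  simp only [deviation, wsum_add, Pi.sub_apply, Pi.add_apply]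
  abel

lemma deviation_mix [DecidableEq ι] {q : ι → ℝ} {T : Matrix ι ι ℝ}
    (hT : T ∈ Matrix.colStochastic ℝ ι) (hTq : T.mulVec q = q) (y : ι → E) :
    deviation q (mix T y) = mix T (deviation q y) := by
  rw [deviation, deviation, mix_sub, mix_const hT, wsum_mix, hTq]

lemma sqNorm_deviation_le (q : ι → ℝ) (y : ι → E) :
    sqNorm (deviation q y) ≤ 2 * (1 + Fintype.card ι * ∑ p, q p ^ 2) * sqNorm y := by
  have h1 := sqNorm_sub_le y (fun _ => wsum q y)
  rw [sqNorm_const] at h1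
  have h2 := mul_le_mul_of_nonneg_left (norm_wsum_sq_le q y)
    (Nat.cast_nonneg (α := ℝ) (Fintype.card ι))
  rw [deviation]
  linarith

/-- One step of the deviation from the centroid, measured by a contracting `lyapunov` form: the
perturbation `e` of the combination step enters quadratically. -/
lemma deviation_step [DecidableEq ι] {q : ι → ℝ} (hq : ∀ p, 0 ≤ q p) (hq1 : ∑ p, q p = 1)
    {T : Matrix ι ι ℝ} (hT : T ∈ Matrix.colStochastic ℝ ι) (hTq : T.mulVec q = q) {k : ℕ} {r : ℝ}
    (hr : 0 < r)
    (hc : ∀ y : ι → E, wsum q y = 0 → lyapunov q T k (mix T y) ≤ (1 - r) * lyapunov q T k y)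
    (y e : ι → E) :
    lyapunov q T k (deviation q (mix T y + e)) ≤ (1 - r / 2) * lyapunov q T k (deviation q y)
      + (1 + 2 / r) * (k * (2 * (1 + Fintype.card ι * ∑ p, q p ^ 2))) * sqNorm e := by
  have h0 := lyapunov_nonneg hq T k (deviation q y)
  -- the parameter `r / 2` of Young's inequality leaves half of the contraction:
  -- `(1 + r / 2) * (1 - r) ≤ 1 - r / 2`
  have h1 := lyapunov_add_le hq T k (half_pos hr) (mix T (deviation q y)) (deviation q e)
  have h2 := mul_le_mul_of_nonneg_left (hc _ (wsum_deviation hq1 y))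
    (show 0 ≤ 1 + r / 2 by positivity)
  have h3 : lyapunov q T k (deviation q e)
      ≤ k * (2 * (1 + Fintype.card ι * ∑ p, q p ^ 2) * sqNorm e) :=
    (lyapunov_le_wSqNorm hq hT hTq k _).trans (mul_le_mul_of_nonneg_left
      ((wSqNorm_le_sqNorm hq _).trans (by rw [hq1, one_mul]; exact sqNorm_deviation_le q e))
      (Nat.cast_nonneg k))
  have h4 := mul_le_mul_of_nonneg_left h3 (show 0 ≤ 1 + 2 / r by positivity)
  have h5 : (1 + r / 2) * ((1 - r) * lyapunov q T k (deviation q y))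
      ≤ (1 - r / 2) * lyapunov q T k (deviation q y) := by
    rw [← mul_assoc]
    exact mul_le_mul_of_nonneg_right (by nlinarith) h0
  rw [deviation_add, deviation_mix hT hTq]
  rw [one_div_div] at h1
  linarith

end Step

/-! ### Bounds for one iteration -/

section Network

variable {ι E : Type*} [Fintype ι] [NormedAddCommGroup E]

/-- The matrix of the noises in combination step `j`: agent `p` receives `a_{j,mp} c_{j,mp}` times
the noise drawn by agent `m`. -/
def noiseMatrix (A : Fin 3 → Matrix ι ι ℝ) (c : Fin 3 → ι → ι → ℝ) (j : Fin 3) : Matrix ι ι ℝ :=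
  Matrix.of fun m p => A j m p * c j m p

/-- The total contribution of the noises drawn in one iteration to the new models. -/
def totalNoise [NormedSpace ℝ E] (A : Fin 3 → Matrix ι ι ℝ) (c : Fin 3 → ι → ι → ℝ)
    (g : Fin 3 → ι → E) : ι → E :=
  mix (noiseMatrix A c 1 * A 0 * A 2) (g 1) + mix (noiseMatrix A c 0 * A 2) (g 0)
    + mix (noiseMatrix A c 2) (g 2)

lemma exists_sqNorm_mix_le [NormedSpace ℝ E] (T : Matrix ι ι ℝ) :
    ∃ K : ℝ, 0 ≤ K ∧ ∀ y : ι → E, sqNorm (mix T y) ≤ K * sqNorm y :=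
  ⟨_, by positivity, sqNorm_mix_le T⟩

lemma exists_sqNorm_totalNoise_le [NormedSpace ℝ E] (A : Fin 3 → Matrix ι ι ℝ)
    (c : Fin 3 → ι → ι → ℝ) :
    ∃ κ : ℝ, 0 ≤ κ ∧ ∀ g : Fin 3 → ι → E, sqNorm (totalNoise A c g) ≤ κ * ∑ j, sqNorm (g j) := by
  obtain ⟨K₁, hK₁, h₁⟩ := exists_sqNorm_mix_le (E := E) (noiseMatrix A c 1 * A 0 * A 2)
  obtain ⟨K₀, hK₀, h₀⟩ := exists_sqNorm_mix_le (E := E) (noiseMatrix A c 0 * A 2)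
  obtain ⟨K₂, hK₂, h₂⟩ := exists_sqNorm_mix_le (E := E) (noiseMatrix A c 2)
  refine ⟨4 * K₁ + 4 * K₀ + 2 * K₂, by positivity, fun g => ?_⟩
  have h1 := h₁ (g 1)
  have h0 := h₀ (g 0)
  have h2 := h₂ (g 2)
  have h3 := sqNorm_add_le (mix (noiseMatrix A c 1 * A 0 * A 2) (g 1))
    (mix (noiseMatrix A c 0 * A 2) (g 0))
  have h4 := sqNorm_add_le (mix (noiseMatrix A c 1 * A 0 * A 2) (g 1)
    + mix (noiseMatrix A c 0 * A 2) (g 0)) (mix (noiseMatrix A c 2) (g 2))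
  have g0 := sqNorm_nonneg (g 0)
  have g1 := sqNorm_nonneg (g 1)
  have g2 := sqNorm_nonneg (g 2)
  rw [totalNoise, Fin.sum_univ_three]
  have := mul_nonneg hK₁ g0
  have := mul_nonneg hK₁ g2
  have := mul_nonneg hK₀ g1
  have := mul_nonneg hK₀ g2
  have := mul_nonneg hK₂ g0
  have := mul_nonneg hK₂ g1
  linarith

/-- All the constants of one iteration at once. For the shifted models `v` of the agents, their
weighted sum `x` and the `lyapunov` form `L` of their deviation from it, every bound is by `x`, `L`,
the drawn noises and the gradient noises, with constants that do not depend on the risks. -/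
lemma exists_iteration_bounds [InnerProductSpace ℝ E] [DecidableEq ι] (A : Fin 3 → Matrix ι ι ℝ)
    (hA : ∀ j, A j ∈ Matrix.colStochastic ℝ ι) (hprim : (A 1 * A 0 * A 2).IsPrimitive)
    {q : ι → ℝ} (hq : ∀ p, 0 < q p) (hq1 : ∑ p, q p = 1) (hTq : (A 1 * A 0 * A 2).mulVec q = q)
    (c : Fin 3 → ι → ι → ℝ) {ν δ ξ : ℝ} (hν : 0 < ν) :
    ∃ (k : ℕ) (r κ : ℝ), 0 < r ∧ r ≤ 1 ∧ 0 < κ ∧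
      (∀ y : ι → E, sqNorm y ≤ κ * lyapunov q (A 1 * A 0 * A 2) k y) ∧
      ∀ (F : ι → E → E), (∀ m, IsDriftingGradient ν δ ξ (F m)) →
      ∀ (μ : ℝ) (v h v' s : ι → E) (g : Fin 3 → ι → E) (X L Γ S : ℝ), 0 ≤ μ →
        X = ‖wsum q v‖ ^ 2 → L = lyapunov q (A 1 * A 0 * A 2) k (deviation q v) →
        Γ = ∑ j, sqNorm (g j) → S = sqNorm s →
        h = mix (A 1) v + mix (noiseMatrix A c 1) (g 1) →
        v' = mix (A 1 * A 0 * A 2) v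
          + (totalNoise A c g - μ • mix (A 2) ((fun m => F m (h m)) + s)) →
        sqNorm h ≤ κ * (X + L + Γ) ∧
        ‖wsum q v'‖ ^ 2 ≤ (1 - ν * μ) * X
          + 2 * inner ℝ (wsum q v) (wsum q (totalNoise A c g) - μ • wsum ((A 2).mulVec q) s)
          + κ * μ * (1 + L + Γ) + κ * Γ + κ * μ ^ 2 * (1 + X + L + Γ + S) ∧
        lyapunov q (A 1 * A 0 * A 2) k (deviation q v')
          ≤ (1 - r) * L + κ * Γ + κ * μ ^ 2 * (1 + X + L + Γ + S) := by
  set T := A 1 * A 0 * A 2 with hTdef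
  have hT : T ∈ Matrix.colStochastic ℝ ι := mul_mem (mul_mem (hA 1) (hA 0)) (hA 2)
  have hq0 : ∀ p, 0 ≤ q p := fun p => (hq p).le
  obtain ⟨k, r, hk, hr, hr1, hc⟩ := exists_lyapunov_contraction (E := E) hq hq1 hT hTq hprim
  obtain ⟨kn, hkn, hn⟩ := exists_sqNorm_totalNoise_le (E := E) A c
  -- the deviation is controlled by the form, and the deviation `z` of `h` from the weighted sum by
  -- the deviation and the drawn noises
  obtain ⟨kl, hkl, hL⟩ : ∃ kl : ℝ, 0 ≤ kl ∧ ∀ y : ι → E, sqNorm y ≤ kl * lyapunov q T k y := by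
    have h0 : 0 ≤ ∑ p, 1 / q p := Finset.sum_nonneg fun p _ => by have := hq p; positivity
    exact ⟨_, h0, fun y => (sqNorm_le_wSqNorm hq y).trans
      (mul_le_mul_of_nonneg_left (wSqNorm_le_lyapunov hq0 T hk y) h0)⟩
  obtain ⟨KA, hKA, hmA⟩ := exists_sqNorm_mix_le (E := E) (A 1)
  obtain ⟨KB, hKB, hmB⟩ := exists_sqNorm_mix_le (E := E) (noiseMatrix A c 1)
  obtain ⟨KC, hKC, hmC⟩ := exists_sqNorm_mix_le (E := E) (A 2)
  obtain ⟨N, hN, hNe⟩ : ∃ N : ℝ, 0 ≤ N ∧ (Fintype.card ι : ℝ) = N := ⟨_, Nat.cast_nonneg _, rfl⟩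
  obtain ⟨Kq, hKq, hKqe⟩ : ∃ K : ℝ, 0 ≤ K ∧ ∑ p, q p ^ 2 = K := ⟨_, by positivity, rfl⟩
  obtain ⟨Kπ, hKπ, hKπe⟩ : ∃ K : ℝ, 0 ≤ K ∧ ∑ p, (A 2).mulVec q p ^ 2 = K :=
    ⟨_, by positivity, rfl⟩
  obtain ⟨Kd, hKd, hKde⟩ : ∃ K : ℝ, 0 ≤ K ∧ (1 + 2 / r) * (k * (2 * (1 + N * Kq))) = K :=
    ⟨_, by positivity, rfl⟩
  set kz : ℝ := 2 * KA * kl + 2 * KB with hkz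
  have hkz0 : 0 ≤ kz := by positivity
  set ku : ℝ := 1 + 3 * δ ^ 2 * (N * ξ ^ 2 + N + kz) with hku
  have hku0 : 0 ≤ ku := by positivity
  set κa : ℝ := 2 * (δ ^ 2 / ν * (ξ ^ 2 + kz)) with hκa
  have hκa0 : 0 ≤ κa := by positivity
  set κb : ℝ := 2 * Kq * kn with hκb
  have hκb0 : 0 ≤ κb := by positivity
  set κc : ℝ := 4 * Kπ * ku with hκc
  have hκc0 : 0 ≤ κc := by positivity
  set κd : ℝ := Kd * (2 * kn) with hκd
  have hκd0 : 0 ≤ κd := by positivity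
  set κe : ℝ := Kd * (4 * KC * ku) with hκe
  have hκe0 : 0 ≤ κe := by positivity
  set κ : ℝ := 1 + kl + (2 * N + 2 * kz) + κa + κb + κc + κd + κe with hκ
  have hκ0 : 0 < κ := by positivity
  clear_value T κ κa κb κc κd κe ku kz
  refine ⟨k, r / 2, κ, by positivity, by linarith, hκ0,
    fun y => (hL y).trans (mul_le_mul_of_nonneg_right (by linarith) (lyapunov_nonneg hq0 T k y)),
    ?_⟩
  intro F hF μ v h v' s g X L Γ S hμ hX hLv hΓ hS hh hv'
  have hX0 : 0 ≤ X := by rw [hX]; positivity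
  have hL0 : 0 ≤ L := by rw [hLv]; exact lyapunov_nonneg hq0 T k _
  have hΓ0 : 0 ≤ Γ := by rw [hΓ]; exact Finset.sum_nonneg fun j _ => sqNorm_nonneg _
  have hS0 : 0 ≤ S := by rw [hS]; exact sqNorm_nonneg _
  set z : ι → E := mix (A 1) (deviation q v) + mix (noiseMatrix A c 1) (g 1) with hz
  have hhz : h = (fun _ => wsum q v) + z := by
    rw [hh, hz, deviation, mix_sub, mix_const (hA 1)]
    abel
  have hZ : sqNorm z ≤ kz * (L + Γ) := by
    have h1 := sqNorm_add_le (mix (A 1) (deviation q v)) (mix (noiseMatrix A c 1) (g 1))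
    have h2 := hmA (deviation q v)
    have h3 := mul_le_mul_of_nonneg_left (hL (deviation q v)) hKA
    have h4 := hmB (g 1)
    have h5 : sqNorm (g 1) ≤ Γ := hΓ ▸ Finset.single_le_sum (f := fun j => sqNorm (g j))
      (fun j _ => sqNorm_nonneg _) (Finset.mem_univ 1)
    have h6 := mul_le_mul_of_nonneg_left h5 hKB
    have h7 : 0 ≤ KA * kl * Γ := by positivity
    have h8 : 0 ≤ KB * L := by positivity
    rw [← hLv] at h3
    rw [hkz]
    linarith
  have hnΓ : sqNorm (totalNoise A c g) ≤ kn * Γ := hΓ ▸ hn g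
  set u : ι → E := fun m => F m (wsum q v + z m) with hu
  have hFh : (fun m => F m (h m)) = u := by
    rw [hhz, hu]; rfl
  have hUS : sqNorm u + S ≤ ku * (1 + X + L + Γ + S) := by
    have h1 := sqNorm_gradient_le hF (wsum q v) z
    rw [← hX, hNe] at h1
    have h2 := mul_le_mul_of_nonneg_left hZ (show 0 ≤ 3 * δ ^ 2 by positivity)
    have h3 : 3 * δ ^ 2 * (N * ξ ^ 2 + N * X + kz * (L + Γ))
        ≤ 3 * δ ^ 2 * ((N * ξ ^ 2 + N + kz) * (1 + X + L + Γ + S)) := by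
      refine mul_le_mul_of_nonneg_left ?_ (by positivity)
      have e1 : N * ξ ^ 2 * 1 ≤ N * ξ ^ 2 * (1 + X + L + Γ + S) :=
        mul_le_mul_of_nonneg_left (by linarith) (by positivity)
      have e2 : N * X ≤ N * (1 + X + L + Γ + S) := mul_le_mul_of_nonneg_left (by linarith) hN
      have e3 : kz * (L + Γ) ≤ kz * (1 + X + L + Γ + S) :=
        mul_le_mul_of_nonneg_left (by linarith) hkz0
      linarith
    rw [hku]
    change sqNorm u ≤ _ at h1
    linarith
  have hQ0 : 0 ≤ μ ^ 2 * (1 + X + L + Γ + S) := by positivity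
  refine ⟨?_, ?_, ?_⟩
  · have h1 := sqNorm_add_le (fun _ => wsum q v) z
    rw [sqNorm_const, ← hX, ← hhz, hNe] at h1
    have h2 : (2 * N + 2 * kz) * (X + L + Γ) ≤ κ * (X + L + Γ) :=
      mul_le_mul_of_nonneg_right (by linarith) (by positivity)
    have h3 : 0 ≤ N * (L + Γ) := by positivity
    have h4 : 0 ≤ kz * X := by positivity
    linarith
  · have hπ0 : ∀ m, 0 ≤ (A 2).mulVec q m := fun m =>
      Finset.sum_nonneg fun p _ => mul_nonneg (Matrix.nonneg_of_mem_colStochastic (hA 2)) (hq0 p)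
    have hπ1 : ∑ m, (A 2).mulVec q m = 1 := by
      rw [Matrix.sum_mulVec_of_mem_colStochastic (hA 2), hq1]
    have h1 := centroid_step hν hF hπ0 hπ1 q hμ (wsum q v) z (totalNoise A c g) s
    have h2 : wsum q v' = wsum q v + wsum q (totalNoise A c g)
        - μ • wsum ((A 2).mulVec q) (u + s) := by
      rw [hv', hFh, wsum_add, wsum_mix, hTq, wsum_sub, wsum_smul, wsum_mix, add_sub_assoc]
    rw [h2]
    rw [← hX, ← hS, hKqe, hKπe] at h1
    have e1 : 2 * μ * (δ ^ 2 / ν * (ξ ^ 2 + sqNorm z)) ≤ κ * μ * (1 + L + Γ) := by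
      have e2 : ξ ^ 2 + sqNorm z ≤ (ξ ^ 2 + kz) * (1 + L + Γ) := by
        have : 0 ≤ ξ ^ 2 * (L + Γ) := by positivity
        linarith
      calc 2 * μ * (δ ^ 2 / ν * (ξ ^ 2 + sqNorm z))
          ≤ 2 * μ * (δ ^ 2 / ν * ((ξ ^ 2 + kz) * (1 + L + Γ))) := by gcongr
        _ = κa * (μ * (1 + L + Γ)) := by rw [hκa]; ring
        _ ≤ κ * (μ * (1 + L + Γ)) := mul_le_mul_of_nonneg_right (by linarith) (by positivity)
        _ = _ := by ring
    have e2 : 2 * Kq * sqNorm (totalNoise A c g) ≤ κ * Γ :=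
      calc 2 * Kq * sqNorm (totalNoise A c g) ≤ 2 * Kq * (kn * Γ) := by gcongr
        _ = κb * Γ := by rw [hκb]; ring
        _ ≤ κ * Γ := mul_le_mul_of_nonneg_right (by linarith) hΓ0
    have e3 : 4 * μ ^ 2 * Kπ * (sqNorm u + S) ≤ κ * μ ^ 2 * (1 + X + L + Γ + S) :=
      calc 4 * μ ^ 2 * Kπ * (sqNorm u + S)
          ≤ 4 * μ ^ 2 * Kπ * (ku * (1 + X + L + Γ + S)) := by gcongr
        _ = κc * (μ ^ 2 * (1 + X + L + Γ + S)) := by rw [hκc]; ring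
        _ ≤ κ * (μ ^ 2 * (1 + X + L + Γ + S)) := mul_le_mul_of_nonneg_right (by linarith) hQ0
        _ = _ := by ring
    linarith
  · have h1 := deviation_step hq0 hq1 hT hTq hr hc v
      (totalNoise A c g - μ • mix (A 2) ((fun m => F m (h m)) + s))
    rw [← hv', ← hLv, hFh, hNe, hKqe, hKde] at h1
    have h2 := sqNorm_sub_le (totalNoise A c g) (μ • mix (A 2) (u + s))
    rw [sqNorm_smul] at h2
    have h3 : sqNorm (mix (A 2) (u + s)) ≤ KC * (2 * (ku * (1 + X + L + Γ + S))) := by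
      refine (hmC _).trans (mul_le_mul_of_nonneg_left ?_ hKC)
      have := sqNorm_add_le u s
      rw [← hS] at this
      linarith
    have h4 := mul_le_mul_of_nonneg_left h3 (sq_nonneg μ)
    have h5 : Kd * sqNorm (totalNoise A c g - μ • mix (A 2) (u + s))
        ≤ κ * Γ + κ * μ ^ 2 * (1 + X + L + Γ + S) :=
      calc Kd * sqNorm (totalNoise A c g - μ • mix (A 2) (u + s))
          ≤ Kd * (2 * (kn * Γ) + 2 * (μ ^ 2 * (KC * (2 * (ku * (1 + X + L + Γ + S)))))) :=
            mul_le_mul_of_nonneg_left (by linarith) hKd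
        _ = κd * Γ + κe * (μ ^ 2 * (1 + X + L + Γ + S)) := by rw [hκd, hκe]; ring
        _ ≤ κ * Γ + κ * (μ ^ 2 * (1 + X + L + Γ + S)) := by
            have i1 := mul_le_mul_of_nonneg_right (show κd ≤ κ by linarith) hΓ0
            have i2 := mul_le_mul_of_nonneg_right (show κe ≤ κ by linarith) hQ0
            linarith
        _ = _ := by ring
    linarith

end Network

/-! ### Gradients of the risks -/

section Risk

lemma hasGradientAt_risk {M N : ℕ} {X : Type*} {Q : Model M → X → ℝ} {x : Fin N → X}
    (h : ∀ n, Differentiable ℝ fun w => Q w (x n)) (w : Model M) :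
    HasGradientAt (risk Q x) ((1 / (N : ℝ)) • ∑ n, gradient (fun w => Q w (x n)) w) w := by
  rw [hasGradientAt_iff_hasFDerivAt, map_smul, map_sum]
  exact (HasFDerivAt.fun_sum fun n _ =>
    ((h n) w).hasGradientAt.hasFDerivAt).const_mul (1 / (N : ℝ))

variable {M P : ℕ} {X : Type*} {N : Fin P → ℕ} {ν δ ξ : ℝ} {Q : Fin P → Model M → X → ℝ}
  {x : (p : Fin P) → Fin (N p) → X} {wo : Model M}

lemma ConvexSmooth.lipschitz_gradient_risk (h : ConvexSmooth ν δ Q x) (p : Fin P)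
    (w₁ w₂ : Model M) :
    ‖gradient (risk (Q p) (x p)) w₁ - gradient (risk (Q p) (x p)) w₂‖ ≤ δ * ‖w₁ - w₂‖ := by
  have hN : (0 : ℝ) < N p := by exact_mod_cast h.data_pos p
  rw [(hasGradientAt_risk (h.diff p) w₁).gradient, (hasGradientAt_risk (h.diff p) w₂).gradient,
    ← smul_sub, ← Finset.sum_sub_distrib, norm_smul, Real.norm_of_nonneg (by positivity)]
  have h1 : ‖∑ n, (gradient (fun w => Q p w (x p n)) w₁ - gradient (fun w => Q p w (x p n)) w₂)‖
      ≤ N p * (δ * ‖w₁ - w₂‖) := by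
    have := norm_sum_le_of_le Finset.univ fun n _ => h.lipschitz_grad p n w₂ w₁
    simpa using this
  calc _ ≤ 1 / (N p : ℝ) * (N p * (δ * ‖w₁ - w₂‖)) := by gcongr
    _ = _ := by field_simp

lemma ConvexSmooth.isDriftingGradient (h : ConvexSmooth ν δ Q x) (hd : ModelDrift ξ Q x wo)
    (hδ : 0 ≤ δ) (p : Fin P) :
    IsDriftingGradient ν δ ξ fun v => gradient (risk (Q p) (x p)) (wo + v) where
  norm_zero_le := by
    obtain ⟨wop, hmin, hξ⟩ := hd.drift p
    have h0 : gradient (risk (Q p) (x p)) wop = 0 := by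
      have : IsLocalMin (risk (Q p) (x p)) wop := Eventually.of_forall hmin
      rw [gradient, this.fderiv_eq_zero, map_zero]
    have h1 := h.lipschitz_gradient_risk p wo wop
    rw [h0, sub_zero] at h1
    rw [add_zero]
    exact h1.trans (mul_le_mul_of_nonneg_left hξ hδ)
  lipschitz a b := by simpa using h.lipschitz_gradient_risk p (wo + a) (wo + b)
  monotone a := by
    have h1 := h.strongly_convex p wo (wo + a)
    have h2 := h.strongly_convex p (wo + a) wo
    rw [add_sub_cancel_left] at h1
    rw [show wo - (wo + a) = -a by abel, norm_neg, inner_neg_right] at h2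
    rw [add_zero, inner_sub_right, real_inner_comm, real_inner_comm _ a]
    linarith

end Risk

/-! ### Square integrable network vectors -/

section Integrability

variable {Ω ι E : Type*} {m m0 : MeasurableSpace Ω} {Pr : Measure Ω} [Fintype ι]
  [NormedAddCommGroup E]

lemma integrable_sqNorm {Y : Ω → ι → E} (hY : ∀ p, MemLp (fun ω => Y ω p) 2 Pr) :
    Integrable (fun ω => sqNorm (Y ω)) Pr :=
  integrable_finsetSum _ fun p _ => (hY p).norm.integrable_sq

variable [InnerProductSpace ℝ E]

lemma memLp_wsum {Y : Ω → ι → E} (hY : ∀ p, MemLp (fun ω => Y ω p) 2 Pr) (q : ι → ℝ) :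
    MemLp (fun ω => wsum q (Y ω)) 2 Pr :=
  memLp_finsetSum _ fun p _ => (hY p).const_smul (q p)

lemma memLp_mix {Y : Ω → ι → E} (hY : ∀ p, MemLp (fun ω => Y ω p) 2 Pr) (T : Matrix ι ι ℝ)
    (p : ι) : MemLp (fun ω => mix T (Y ω) p) 2 Pr :=
  memLp_wsum hY fun m => T m p

lemma integrable_lyapunov [DecidableEq ι] {Y : Ω → ι → E}
    (hY : ∀ p, MemLp (fun ω => Y ω p) 2 Pr) (q : ι → ℝ) (T : Matrix ι ι ℝ) (k : ℕ) :
    Integrable (fun ω => lyapunov q T k (Y ω)) Pr :=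
  integrable_finsetSum _ fun j _ => integrable_finsetSum _ fun p _ =>
    (memLp_mix hY (T ^ j) p).norm.integrable_sq.const_mul (q p)

lemma integrable_real_inner {f g : Ω → E} (hf : MemLp f 2 Pr) (hg : MemLp g 2 Pr) :
    Integrable (fun ω => inner ℝ (f ω) (g ω)) Pr := by
  refine (hf.norm.integrable_mul hg.norm).mono (hf.1.inner hg.1) (Eventually.of_forall fun ω => ?_)
  simpa using abs_real_inner_le_norm (f ω) (g ω)

/-- A square integrable vector with zero conditional mean is orthogonal to the past. -/
lemma integral_inner_eq_zero [CompleteSpace E] [IsFiniteMeasure Pr] (hm : m ≤ m0) {f g : Ω → E}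
    (hfm : StronglyMeasurable[m] f) (hf : MemLp f 2 Pr) (hg : MemLp g 2 Pr)
    (h0 : Pr[g | m] =ᵐ[Pr] 0) : ∫ ω, inner ℝ (f ω) (g ω) ∂Pr = 0 := by
  have h1 := condExp_bilin_of_stronglyMeasurable_left (innerSL ℝ) hfm
    (integrable_real_inner hf hg) (hg.integrable (by norm_num))
  rw [← integral_condExp hm]
  refine integral_eq_zero_of_ae ?_
  filter_upwards [h1, h0] with ω e1 e2
  refine e1.trans ?_
  rw [e2]
  simp

lemma integral_inner_wsum_eq_zero [CompleteSpace E] [IsFiniteMeasure Pr] (hm : m ≤ m0)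
    {f : Ω → E} {Y : Ω → ι → E} (hfm : StronglyMeasurable[m] f)
    (hf : MemLp f 2 Pr) (hY : ∀ p, MemLp (fun ω => Y ω p) 2 Pr)
    (h0 : ∀ p, Pr[fun ω => Y ω p | m] =ᵐ[Pr] 0) (q : ι → ℝ) :
    ∫ ω, inner ℝ (f ω) (wsum q (Y ω)) ∂Pr = 0 := by
  simp only [wsum, inner_sum, inner_smul_right]
  rw [integral_finsetSum _ fun p _ => (integrable_real_inner hf (hY p)).const_mul (q p)]
  refine Finset.sum_eq_zero fun p _ => ?_
  rw [integral_const_mul, integral_inner_eq_zero hm hfm hf (hY p) (h0 p), mul_zero]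

/-- An affine pointwise bound passes to expectations with the same coefficients. -/
lemma integral_le_linear [IsProbabilityMeasure Pr] {f X L Γ S I : Ω → ℝ} (hf : Integrable f Pr)
    (hX : Integrable X Pr) (hL : Integrable L Pr) (hΓ : Integrable Γ Pr) (hS : Integrable S Pr)
    (hI : Integrable I Pr) (a₀ a₁ a₂ a₃ a₄ a₅ : ℝ)
    (h : ∀ ω, f ω ≤ a₀ + a₁ * X ω + a₂ * L ω + a₃ * Γ ω + a₄ * S ω + a₅ * I ω) :
    ∫ ω, f ω ∂Pr ≤ a₀ + a₁ * ∫ ω, X ω ∂Pr + a₂ * ∫ ω, L ω ∂Pr + a₃ * ∫ ω, Γ ω ∂Pr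
      + a₄ * ∫ ω, S ω ∂Pr + a₅ * ∫ ω, I ω ∂Pr := by
  have h1 := (integrable_const a₀ (μ := Pr)).add (hX.const_mul a₁)
  have h2 := h1.add (hL.const_mul a₂)
  have h3 := h2.add (hΓ.const_mul a₃)
  have h4 := h3.add (hS.const_mul a₄)
  refine (integral_mono hf (h4.add (hI.const_mul a₅)) h).trans (le_of_eq ?_)
  rw [integral_add' h4 (hI.const_mul a₅), integral_add' h3 (hS.const_mul a₄),
    integral_add' h2 (hΓ.const_mul a₃), integral_add' h1 (hL.const_mul a₂),
    integral_add' (integrable_const a₀) (hX.const_mul a₁)]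
  simp only [integral_const_mul, integral_const, probReal_univ, one_smul]

end Integrability

/-! ### Moments along a run -/

section Run

variable {M P : ℕ} {Ω : Type*}
  {A : Fin 3 → Matrix (Fin P) (Fin P) ℝ} {q : Fin P → ℝ} {c : Fin 3 → Fin P → Fin P → ℝ}
  {J : Fin P → Model M → ℝ} {wo : Model M} {β σs : Fin P → ℝ} {μ σg : ℝ}
  {g : Fin 3 → Fin P → ℕ → Ω → Model M} {G φ ψ w : Fin P → ℕ → Ω → Model M}

lemma combine_eq (j : Fin 3) (i : ℕ) (ω : Ω) (y : Fin P → Model M) :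
    (fun p => ∑ m, A j m p • (y m + edgeNoise c g j m p i ω))
      = mix (A j) y + mix (noiseMatrix A c j) (fun m => g j m i ω) := by
  funext p
  simp [mix, noiseMatrix, edgeNoise, smul_add, smul_smul, Finset.sum_add_distrib]

/-- The models of all agents at time `i`, with the origin moved to `wo`. -/
def shiftedModels (wo : Model M) (w : Fin P → ℕ → Ω → Model M) (i : ℕ) (ω : Ω) :
    Fin P → Model M :=
  fun p => w p i ω - wo

/-- The noises drawn by all agents in iteration `i`. -/
def drawnNoises (g : Fin 3 → Fin P → ℕ → Ω → Model M) (i : ℕ) (ω : Ω) :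
    Fin 3 → Fin P → Model M :=
  fun j m => g j m i ω

/-- The gradient noises of all agents in iteration `i + 1`. -/
noncomputable def gradNoises (J : Fin P → Model M → ℝ) (G φ : Fin P → ℕ → Ω → Model M) (i : ℕ)
    (ω : Ω) : Fin P → Model M :=
  fun p => G p (i + 1) ω - gradient (J p) (φ p i ω)

lemma stronglyMeasurable_wsum_shiftedModels (q : Fin P → ℝ) (wo : Model M)
    (w : Fin P → ℕ → Ω → Model M) (i : ℕ) :
    StronglyMeasurable[pastModels w i] fun ω => wsum q (shiftedModels wo w i ω) := by
  have h1 : ∀ p, StronglyMeasurable[pastModels w i] (w p i) := fun p => by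
    have h2 : MeasurableSpace.comap (w p i) inferInstance ≤ pastModels w i :=
      le_iSup_of_le i (le_iSup_of_le le_rfl (le_iSup_of_le p le_rfl))
    exact ((comap_measurable (w p i)).mono h2 le_rfl).stronglyMeasurable
  exact Finset.stronglyMeasurable_fun_sum _ fun p _ =>
    ((h1 p).sub stronglyMeasurable_const).const_smul (q p)

variable [m0 : MeasurableSpace Ω] {Pr : Measure Ω}

lemma measurable_combine {f f' : Fin P → Ω → Model M} (hf : ∀ m, Measurable (f m))
    (hf' : ∀ m, Measurable (f' m)) (a b : Fin P → ℝ) :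
    Measurable fun ω => ∑ m, a m • (f m ω + b m • f' m ω) :=
  Finset.measurable_fun_sum _ fun m _ => ((hf m).add ((hf' m).const_smul (b m))).const_smul (a m)

lemma memLp_combine {f f' : Fin P → Ω → Model M} (hf : ∀ m, MemLp (f m) 2 Pr)
    (hf' : ∀ m, MemLp (f' m) 2 Pr) (a b : Fin P → ℝ) :
    MemLp (fun ω => ∑ m, a m • (f m ω + b m • f' m ω)) 2 Pr :=
  memLp_finsetSum _ fun m _ => ((hf m).add ((hf' m).const_smul (b m))).const_smul (a m)

namespace IsPrivatizedRun

lemma phi_sub_eq (h : IsPrivatizedRun Pr A q c J wo β σs μ σg g G φ ψ w)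
    (hA : ∀ j, A j ∈ Matrix.colStochastic ℝ (Fin P)) (i : ℕ) (ω : Ω) :
    (fun p => φ p i ω - wo) = mix (A 1) (shiftedModels wo w i ω)
      + mix (noiseMatrix A c 1) (drawnNoises g (i + 1) ω 1) := by
  have h1 : (fun p => φ p i ω) = _ := (funext fun p => h.pre_combine p i ω).trans
    (combine_eq 1 (i + 1) ω fun m => w m i ω)
  have h2 : (fun p => φ p i ω - wo) = (fun p => φ p i ω) - fun _ => wo := rfl
  have h3 : shiftedModels wo w i ω = (fun p => w p i ω) - fun _ => wo := rfl
  rw [h2, h1, h3, mix_sub, mix_const (hA 1)]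
  rw [show drawnNoises g (i + 1) ω 1 = fun m => g 1 m (i + 1) ω from rfl]
  abel

lemma shiftedModels_succ (h : IsPrivatizedRun Pr A q c J wo β σs μ σg g G φ ψ w)
    (hA : ∀ j, A j ∈ Matrix.colStochastic ℝ (Fin P)) (i : ℕ) (ω : Ω) :
    shiftedModels wo w (i + 1) ω = mix (A 1 * A 0 * A 2) (shiftedModels wo w i ω)
      + (totalNoise A c (drawnNoises g (i + 1) ω) - μ • mix (A 2) fun m => G m (i + 1) ω) := by
  have h1 : (fun p => φ p i ω) = _ := (funext fun p => h.pre_combine p i ω).trans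
    (combine_eq 1 (i + 1) ω fun m => w m i ω)
  have h2 : (fun p => ψ p (i + 1) ω) = (fun p => ∑ m, A 0 m p • (φ m i ω
      + edgeNoise c g 0 m p (i + 1) ω)) - μ • fun p => G p (i + 1) ω :=
    funext fun p => h.update p i ω
  rw [combine_eq 0 (i + 1) ω fun m => φ m i ω, h1] at h2
  have h3 : (fun p => w p (i + 1) ω) = _ := (funext fun p => h.post_combine p i ω).trans
    (combine_eq 2 (i + 1) ω fun m => ψ m (i + 1) ω)
  rw [h2] at h3
  have h4 : shiftedModels wo w (i + 1) ω = (fun p => w p (i + 1) ω) - fun _ => wo := rfl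
  have h5 : shiftedModels wo w i ω = (fun p => w p i ω) - fun _ => wo := rfl
  have hT : A 1 * A 0 * A 2 ∈ Matrix.colStochastic ℝ (Fin P) :=
    mul_mem (mul_mem (hA 1) (hA 0)) (hA 2)
  rw [h4, h5, h3, mix_sub (A 1 * A 0 * A 2), mix_const hT]
  have hg : ∀ j, drawnNoises g (i + 1) ω j = fun m => g j m (i + 1) ω := fun _ => rfl
  simp only [mix_add, mix_sub, mix_smul, mix_mix, totalNoise, hg]
  abel

lemma measurable_phi (h : IsPrivatizedRun Pr A q c J wo β σs μ σg g G φ ψ w) {i : ℕ}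
    (hw : ∀ p, Measurable (w p i)) (p : Fin P) : Measurable (φ p i) := by
  have : φ p i = fun ω => ∑ m, A 1 m p • (w m i ω + c 1 m p • g 1 m (i + 1) ω) :=
    funext fun ω => h.pre_combine p i ω
  rw [this]
  exact measurable_combine hw (fun m => h.noise_measurable 1 m i) _ _

lemma measurable_models (h : IsPrivatizedRun Pr A q c J wo β σs μ σg g G φ ψ w) (i : ℕ) :
    ∀ p, Measurable (w p i) := by
  induction i with
  | zero => exact h.init_measurable
  | succ i ih =>
    have hψ : ∀ p, Measurable (ψ p (i + 1)) := fun p => by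
      have : ψ p (i + 1) = fun ω => ∑ m, A 0 m p • (φ m i ω + c 0 m p • g 0 m (i + 1) ω)
          - μ • G p (i + 1) ω := funext fun ω => h.update p i ω
      rw [this]
      exact (measurable_combine (h.measurable_phi ih) (fun m => h.noise_measurable 0 m i) _ _).sub
        ((h.grad_measurable p i).const_smul μ)
    intro p
    have : w p (i + 1) = fun ω => ∑ m, A 2 m p • (ψ m (i + 1) ω + c 2 m p • g 2 m (i + 1) ω) :=
      funext fun ω => h.post_combine p i ω
    rw [this]
    exact measurable_combine hψ (fun m => h.noise_measurable 2 m i) _ _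

lemma pastModels_le (h : IsPrivatizedRun Pr A q c J wo β σs μ σg g G φ ψ w) (i : ℕ) :
    pastModels w i ≤ m0 :=
  iSup_le fun j => iSup_le fun _ => iSup_le fun p => (h.measurable_models j p).comap_le

lemma memLp_phi (h : IsPrivatizedRun Pr A q c J wo β σs μ σg g G φ ψ w) {i : ℕ}
    (hw : ∀ p, MemLp (w p i) 2 Pr) (p : Fin P) : MemLp (φ p i) 2 Pr := by
  have : φ p i = fun ω => ∑ m, A 1 m p • (w m i ω + c 1 m p • g 1 m (i + 1) ω) :=
    funext fun ω => h.pre_combine p i ω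
  rw [this]
  exact memLp_combine hw (fun m => h.noise_memLp 1 m i) _ _

lemma integral_drawnNoises_le (h : IsPrivatizedRun Pr A q c J wo β σs μ σg g G φ ψ w) (i : ℕ) :
    ∫ ω, ∑ j, sqNorm (drawnNoises g (i + 1) ω j) ∂Pr ≤ 3 * P * M * σg ^ 2 := by
  have h1 : ∀ j p, ∫ ω, ‖g j p (i + 1) ω‖ ^ 2 ∂Pr ≤ M * σg ^ 2 := fun j p => by
    simp only [EuclideanSpace.norm_sq_eq, Real.norm_eq_abs, sq_abs]
    have hint : ∀ k, Integrable (fun ω => (g j p (i + 1) ω k) ^ 2) Pr := fun k => by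
      refine MemLp.integrable_sq ((h.noise_memLp j p i).of_le
        ((EuclideanSpace.proj (𝕜 := ℝ) k).continuous.comp_aestronglyMeasurable
          (h.noise_memLp j p i).1) (Eventually.of_forall fun ω => ?_))
      exact PiLp.norm_apply_le _ _
    rw [integral_finsetSum _ fun k _ => hint k]
    refine (Finset.sum_le_sum fun k _ => h.noise_variance j p i k).trans (le_of_eq ?_)
    simp
  have h2 : ∀ j p, Integrable (fun ω => ‖g j p (i + 1) ω‖ ^ 2) Pr := fun j p =>
    (h.noise_memLp j p i).norm.integrable_sq
  simp only [sqNorm, drawnNoises]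
  rw [integral_finsetSum _ fun j _ => integrable_finsetSum _ fun p _ => h2 j p]
  simp only [integral_finsetSum _ fun p _ => h2 _ p]
  refine (Finset.sum_le_sum fun j _ => Finset.sum_le_sum fun p _ => h1 j p).trans (le_of_eq ?_)
  simp
  ring

variable [IsProbabilityMeasure Pr]

lemma memLp_models (h : IsPrivatizedRun Pr A q c J wo β σs μ σg g G φ ψ w) {δ : ℝ}
    (hJ : ∀ p a b, ‖gradient (J p) a - gradient (J p) b‖ ≤ δ * ‖a - b‖) (i : ℕ) :
    ∀ p, MemLp (w p i) 2 Pr := by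
  induction i with
  | zero => exact h.init_memLp
  | succ i ih =>
    have hgrad : ∀ p, MemLp (fun ω => gradient (J p) (φ p i ω)) 2 Pr := fun p => by
      have hφ := h.memLp_phi ih p
      have hcont : Continuous (gradient (J p)) :=
        (LipschitzWith.of_dist_le' (K := δ) fun a b => by
          simpa [dist_eq_norm] using hJ p a b).continuous
      have h1 : MemLp (fun ω => gradient (J p) (φ p i ω) - gradient (J p) 0) 2 Pr :=
        hφ.of_le_mul (c := δ) ((hcont.comp_aestronglyMeasurable hφ.1).sub
          aestronglyMeasurable_const) (Eventually.of_forall fun ω => by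
            simpa using hJ p (φ p i ω) 0)
      refine (h1.add (memLp_const (gradient (J p) 0))).ae_eq (Eventually.of_forall fun ω => ?_)
      simp
    have hG : ∀ p, MemLp (G p (i + 1)) 2 Pr := fun p => by
      refine ((h.gradNoise_memLp p i).add (hgrad p)).ae_eq (Eventually.of_forall fun ω => ?_)
      simp
    have hψ : ∀ p, MemLp (ψ p (i + 1)) 2 Pr := fun p => by
      have : ψ p (i + 1) = fun ω => ∑ m, A 0 m p • (φ m i ω + c 0 m p • g 0 m (i + 1) ω)
          - μ • G p (i + 1) ω := funext fun ω => h.update p i ω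
      rw [this]
      exact (memLp_combine (h.memLp_phi ih) (fun m => h.noise_memLp 0 m i) _ _).sub
        ((hG p).const_smul μ)
    intro p
    have : w p (i + 1) = fun ω => ∑ m, A 2 m p • (ψ m (i + 1) ω + c 2 m p • g 2 m (i + 1) ω) :=
      funext fun ω => h.post_combine p i ω
    rw [this]
    exact memLp_combine hψ (fun m => h.noise_memLp 2 m i) _ _

lemma integral_gradNoises_le (h : IsPrivatizedRun Pr A q c J wo β σs μ σg g G φ ψ w) {i : ℕ}
    (hw : ∀ p, MemLp (w p i) 2 Pr) :
    ∫ ω, sqNorm (gradNoises J G φ i ω) ∂Pr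
      ≤ (∑ p, β p ^ 2) * (∫ ω, sqNorm (fun p => φ p i ω - wo) ∂Pr) + ∑ p, σs p ^ 2 := by
  have hφ : ∀ p, Integrable (fun ω => ‖φ p i ω - wo‖ ^ 2) Pr := fun p =>
    ((h.memLp_phi hw p).sub (memLp_const wo)).norm.integrable_sq
  have h1 : ∀ p, ∫ ω, ‖gradNoises J G φ i ω p‖ ^ 2 ∂Pr
      ≤ β p ^ 2 * (∫ ω, sqNorm (fun p => φ p i ω - wo) ∂Pr) + σs p ^ 2 := fun p => by
    have e1 := integral_mono_ae integrable_condExp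
      ((integrable_condExp.const_mul (β p ^ 2)).add (integrable_const (σs p ^ 2)))
      (h.gradNoise_variance p i)
    rw [integral_condExp (h.pastModels_le i)] at e1
    refine e1.trans ?_
    rw [integral_add' (integrable_condExp.const_mul (β p ^ 2)) (integrable_const _),
      integral_const_mul, integral_condExp (h.pastModels_le i)]
    simp only [integral_const, probReal_univ, one_smul]
    gcongr ?_ + _
    refine mul_le_mul_of_nonneg_left ?_ (sq_nonneg _)
    simp only [norm_sub_rev wo]
    exact integral_mono (hφ p) (integrable_finsetSum _ fun p _ => hφ p)
      fun ω => norm_sq_le_sqNorm (fun p => φ p i ω - wo) p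
  have h2 : ∫ ω, sqNorm (gradNoises J G φ i ω) ∂Pr
      = ∑ p, ∫ ω, ‖gradNoises J G φ i ω p‖ ^ 2 ∂Pr :=
    integral_finsetSum _ fun p _ => (h.gradNoise_memLp p i).norm.integrable_sq
  rw [h2, Finset.sum_mul, ← Finset.sum_add_distrib]
  exact Finset.sum_le_sum fun p _ => h1 p

/-- All the noises of an iteration are orthogonal to the centroid error before it. -/
lemma integral_inner_noise_eq_zero (h : IsPrivatizedRun Pr A q c J wo β σs μ σg g G φ ψ w) {i : ℕ}
    (hw : ∀ p, MemLp (w p i) 2 Pr) (r π : Fin P → ℝ) (τ : ℝ) :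
    Integrable (fun ω => inner ℝ (wsum r (shiftedModels wo w i ω))
      (wsum r (totalNoise A c (drawnNoises g (i + 1) ω))
        - τ • wsum π (gradNoises J G φ i ω))) Pr ∧
    ∫ ω, inner ℝ (wsum r (shiftedModels wo w i ω))
      (wsum r (totalNoise A c (drawnNoises g (i + 1) ω))
        - τ • wsum π (gradNoises J G φ i ω)) ∂Pr = 0 := by
  have hm := h.pastModels_le i
  have hxm := stronglyMeasurable_wsum_shiftedModels r wo w i
  have hx : MemLp (fun ω => wsum r (shiftedModels wo w i ω)) 2 Pr :=
    memLp_wsum (Y := shiftedModels wo w i) (fun p => (hw p).sub (memLp_const wo)) r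
  have hg : ∀ j p, MemLp (fun ω => drawnNoises g (i + 1) ω j p) 2 Pr := fun j p =>
    h.noise_memLp j p i
  have hg0 : ∀ j (b : Fin P → ℝ), ∫ ω, inner ℝ (wsum r (shiftedModels wo w i ω))
      (wsum b (drawnNoises g (i + 1) ω j)) ∂Pr = 0 := fun j b =>
    integral_inner_wsum_eq_zero hm hxm hx (hg j) (fun p => h.noise_mean j p i) b
  have hgi : ∀ j (b : Fin P → ℝ), Integrable (fun ω => inner ℝ (wsum r (shiftedModels wo w i ω))
      (wsum b (drawnNoises g (i + 1) ω j))) Pr := fun j b =>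
    integrable_real_inner hx (memLp_wsum (hg j) b)
  have hs : ∀ p, MemLp (fun ω => gradNoises J G φ i ω p) 2 Pr := fun p => h.gradNoise_memLp p i
  have hs0 := integral_inner_wsum_eq_zero hm hxm hx hs (fun p => h.gradNoise_mean p i) π
  have hsi := integrable_real_inner hx (memLp_wsum hs π)
  simp only [totalNoise, wsum_add, wsum_mix, inner_sub_right, inner_add_right, inner_smul_right]
  have i1 := (hgi 1 ((noiseMatrix A c 1 * A 0 * A 2).mulVec r)).add
    (hgi 0 ((noiseMatrix A c 0 * A 2).mulVec r))
  have i2 := i1.add (hgi 2 ((noiseMatrix A c 2).mulVec r))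
  have i3 := i2.sub (hsi.const_mul τ)
  refine ⟨i3, (integral_sub' i2 (hsi.const_mul τ)).trans ?_⟩
  rw [integral_add' i1 (hgi 2 _), integral_add' (hgi 1 _) (hgi 0 _), integral_const_mul, hs0]
  simp [hg0]

end IsPrivatizedRun

end Run

/-! ### The bound on the network disagreement -/

lemma limsup_le_of_le_add_geometric {u : ℕ → ℝ} {d K θ : ℝ} (hu : ∀ i, 0 ≤ u i) (hθ0 : 0 ≤ θ)
    (hθ1 : θ < 1) (h : ∀ i, u i ≤ d + K * θ ^ i) : limsup u atTop ≤ d := by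
  have ht : Tendsto (fun i : ℕ => d + K * θ ^ i) atTop (𝓝 d) := by
    simpa using ((tendsto_pow_atTop_nhds_zero_of_lt_one hθ0 hθ1).const_mul K).const_add d
  rw [← ht.limsup_eq]
  -- on `ℝ` comparing limsups needs boundedness, from below for `u` and from above for the majorant
  exact limsup_le_limsup (Eventually.of_forall h)
    (isBoundedUnder_of ⟨0, hu⟩ : IsBoundedUnder (· ≥ ·) atTop u).isCoboundedUnder_le
    ht.isBoundedUnder_le

/-- The constants of `exists_iteration_bounds` after taking expectations, for one iteration with
`E Γ ≤ kg s` and `E S ≤ kβ E‖h‖² + kσ`. -/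
lemma moment_terms_le {κ kg kβ kσ : ℝ} (hκ : 0 < κ) (hkg : 0 ≤ kg) (hkβ : 0 ≤ kβ) (hkσ : 0 ≤ kσ)
    {μ s V D EΓ ES : ℝ} (hμ : 0 ≤ μ) (hs : 0 ≤ s) (hV : 0 ≤ V) (hD : 0 ≤ D)
    (hΓ0 : 0 ≤ EΓ) (hΓ : EΓ ≤ kg * s) (hS : ES ≤ kβ * (κ * (V + D + EΓ)) + kσ) :
    κ * μ * (1 + D + EΓ) ≤ κ * (1 + kσ + kβ * κ) * (1 + kg) * μ * (1 + D + s) ∧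
    κ * EΓ ≤ κ * (1 + kσ + kβ * κ) * (1 + kg) * s ∧
    κ * μ ^ 2 * (1 + V + D + EΓ + ES)
      ≤ κ * (1 + kσ + kβ * κ) * (1 + kg) * μ ^ 2 * (1 + V + D + s) := by
  obtain ⟨b, hb, hbe⟩ : ∃ b : ℝ, 1 ≤ b ∧ 1 + kσ + kβ * κ = b :=
    ⟨_, by linarith [mul_nonneg hkβ hκ.le], rfl⟩
  have h1 : ∀ t : ℝ, 0 ≤ t → t + EΓ ≤ (1 + kg) * (t + s) := fun t ht => by
    linarith [mul_nonneg hkg ht]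
  have h2 : ∀ t : ℝ, 0 ≤ t → t + EΓ ≤ b * (1 + kg) * (t + s) := fun t ht => by
    have : 1 * ((1 + kg) * (t + s)) ≤ b * ((1 + kg) * (t + s)) :=
      mul_le_mul_of_nonneg_right hb (by positivity)
    linarith [h1 t ht]
  -- the noises of this iteration and the gradient noises only add multiples of `1 + V + D + s`
  have h3 : 1 + V + D + EΓ + ES ≤ b * (1 + kg) * (1 + V + D + s) := by
    have e1 : b * (1 + V + D + EΓ) ≤ b * ((1 + kg) * (1 + V + D + s)) :=
      mul_le_mul_of_nonneg_left (h1 (1 + V + D) (by positivity)) (by linarith)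
    have e2 : 0 ≤ kσ * (V + D + EΓ) + kβ * κ := by positivity
    rw [← hbe] at e1 ⊢
    linarith
  rw [hbe]
  refine ⟨?_, ?_, ?_⟩
  · have := mul_le_mul_of_nonneg_left (h2 (1 + D) (by positivity)) (mul_nonneg hκ.le hμ)
    linarith
  · have := mul_le_mul_of_nonneg_left (h2 0 le_rfl) hκ.le
    linarith
  · have := mul_le_mul_of_nonneg_left h3 (mul_nonneg hκ.le (sq_nonneg μ))
    linarith

theorem lemma1 {M P : ℕ}
    -- the network: combination matrices, Perron vector, coefficients of the perturbations
    (A : Fin 3 → Matrix (Fin P) (Fin P) ℝ)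
    (hA : ∀ j, A j ∈ Matrix.colStochastic ℝ (Fin P))
    (hprim : (A 1 * A 0 * A 2).IsPrimitive)
    (q : Fin P → ℝ) (hq : IsPerronVector (A 1 * A 0 * A 2) q)
    (c : Fin 3 → Fin P → Fin P → ℝ)
    -- the constants of the assumptions on the risks and on the gradient noise
    (ν δ ξ : ℝ) (hν : 0 < ν) (hδ : 0 < δ) (hξ : 0 ≤ ξ) (β σs : Fin P → ℝ) :
    ∃ μ₀ C₁ C₂ : ℝ, 0 < μ₀ ∧ 0 ≤ C₁ ∧ 0 ≤ C₂ ∧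
      ∀ (X : Type*) (N : Fin P → ℕ) (Q : Fin P → Model M → X → ℝ)
        (x : (p : Fin P) → Fin (N p) → X) (wo : Model M),
        ConvexSmooth ν δ Q x → ModelDrift ξ Q x wo →
      ∀ (Ω : Type*) [MeasurableSpace Ω] (Pr : Measure Ω) [IsProbabilityMeasure Pr] (μ σg : ℝ)
        (g : Fin 3 → Fin P → ℕ → Ω → Model M) (G φ ψ w : Fin P → ℕ → Ω → Model M),
        0 < μ → μ < μ₀ →
        IsPrivatizedRun Pr A q c (fun p => risk (Q p) (x p)) wo β σs μ σg g G φ ψ w →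
          (∀ p i, MemLp (fun ω => w p i ω - centroid q w i ω) 2 Pr) ∧
          (∃ B : ℝ, ∀ i, disagreement Pr q w i ≤ B) ∧
          limsup (fun i => disagreement Pr q w i) atTop ≤ C₁ * σg ^ 2 + C₂ * μ := by
  obtain ⟨k, r, κ, hr, hr1, hκ, hsq, hiter⟩ := exists_iteration_bounds (E := Model M) A hA hprim
    hq.pos hq.sum_eq_one hq.eigen c (δ := δ) (ξ := ξ) hν
  set kg : ℝ := 3 * P * M with hkg
  have hkg0 : 0 ≤ kg := by positivity
  set kβ : ℝ := ∑ p, β p ^ 2 with hkβ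
  have hkβ0 : 0 ≤ kβ := by positivity
  set kσ : ℝ := ∑ p, σs p ^ 2 with hkσ
  have hkσ0 : 0 ≤ kσ := by positivity
  obtain ⟨μ₀, C₁, C₂, hμ₀, hC₁, hC₂, hrec⟩ := coupled_recursion_bound_second_order (ν := ν)
    (κ := κ * (1 + kσ + kβ * κ) * (1 + kg)) (r := r) hν (by positivity) hr hr1
  refine ⟨μ₀, κ * C₁, κ * C₂, hμ₀, by positivity, by positivity, ?_⟩
  intro X N Q x wo hQ hdrift Ω _ Pr _ μ σg g G φ ψ w hμ hμμ₀ hrun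
  set J : Fin P → Model M → ℝ := fun p => risk (Q p) (x p) with hJ
  have hw := hrun.memLp_models hQ.lipschitz_gradient_risk
  have hF := fun p => hQ.isDriftingGradient hdrift hδ.le p
  have hv : ∀ i p, MemLp (fun ω => shiftedModels wo w i ω p) 2 Pr := fun i p =>
    (hw i p).sub (memLp_const wo)
  have hx : ∀ i, MemLp (fun ω => wsum q (shiftedModels wo w i ω)) 2 Pr := fun i =>
    memLp_wsum (hv i) q
  have hy : ∀ i p, MemLp (fun ω => deviation q (shiftedModels wo w i ω) p) 2 Pr := fun i p =>
    (hv i p).sub (hx i)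
  set T := A 1 * A 0 * A 2 with hT
  set V : ℕ → ℝ := fun i => ∫ ω, ‖wsum q (shiftedModels wo w i ω)‖ ^ 2 ∂Pr with hV
  set D : ℕ → ℝ := fun i => ∫ ω, lyapunov q T k (deviation q (shiftedModels wo w i ω)) ∂Pr with hD
  have hV0 : ∀ i, 0 ≤ V i := fun i => integral_nonneg fun ω => by positivity
  have hD0 : ∀ i, 0 ≤ D i := fun i => integral_nonneg fun ω =>
    lyapunov_nonneg (fun p => (hq.pos p).le) T k _
  have hs0 : 0 ≤ σg ^ 2 := sq_nonneg _
  -- one iteration, in expectation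
  have hstep : ∀ i, V (i + 1) ≤ (1 - ν * μ) * V i
        + κ * (1 + kσ + kβ * κ) * (1 + kg) * μ * (1 + D i + σg ^ 2)
        + κ * (1 + kσ + kβ * κ) * (1 + kg) * σg ^ 2
        + κ * (1 + kσ + kβ * κ) * (1 + kg) * μ ^ 2 * (1 + V i + D i + σg ^ 2) ∧
      D (i + 1) ≤ (1 - r) * D i + κ * (1 + kσ + kβ * κ) * (1 + kg) * σg ^ 2
        + κ * (1 + kσ + kβ * κ) * (1 + kg) * μ ^ 2 * (1 + V i + D i + σg ^ 2) := by
    intro i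
    have hG : ∀ ω, (fun m => G m (i + 1) ω)
        = (fun m => gradient (J m) (wo + (φ m i ω - wo))) + gradNoises J G φ i ω := fun ω => by
      funext m; simp [gradNoises]
    have hb := fun ω => hiter _ hF μ (shiftedModels wo w i ω) (fun p => φ p i ω - wo)
      (shiftedModels wo w (i + 1) ω) (gradNoises J G φ i ω) (drawnNoises g (i + 1) ω) _ _ _ _ hμ.le
      rfl rfl rfl rfl (hrun.phi_sub_eq hA i ω)
      (by rw [hrun.shiftedModels_succ hA i ω, hG ω])
    have iX := (hx i).norm.integrable_sq
    have iL := integrable_lyapunov (hy i) q T k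
    have iΓ : Integrable (fun ω => ∑ j, sqNorm (drawnNoises g (i + 1) ω j)) Pr :=
      integrable_finsetSum _ fun j _ => integrable_sqNorm fun p => hrun.noise_memLp j p i
    have iS : Integrable (fun ω => sqNorm (gradNoises J G φ i ω)) Pr :=
      integrable_sqNorm fun p => hrun.gradNoise_memLp p i
    have ih : Integrable (fun ω => sqNorm fun p => φ p i ω - wo) Pr :=
      integrable_sqNorm fun p => (hrun.memLp_phi (hw i) p).sub (memLp_const wo)
    obtain ⟨iI, hI⟩ := hrun.integral_inner_noise_eq_zero (hw i) q ((A 2).mulVec q) μ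
    have hΓ := hrun.integral_drawnNoises_le i
    have hΓ0 : 0 ≤ ∫ ω, ∑ j, sqNorm (drawnNoises g (i + 1) ω j) ∂Pr :=
      integral_nonneg fun ω => Finset.sum_nonneg fun j _ => sqNorm_nonneg _
    have hS := hrun.integral_gradNoises_le (hw i)
    have b1 := integral_le_linear ih iX iL iΓ iS iI 0 κ κ κ 0 0
      fun ω => by linarith [(hb ω).1]
    have b2 := integral_le_linear (hx (i + 1)).norm.integrable_sq iX iL iΓ iS iI
      (κ * μ + κ * μ ^ 2) (1 - ν * μ + κ * μ ^ 2) (κ * μ + κ * μ ^ 2) (κ * μ + κ + κ * μ ^ 2)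
      (κ * μ ^ 2) 2 fun ω => by linarith [(hb ω).2.1]
    have b3 := integral_le_linear (integrable_lyapunov (hy (i + 1)) q T k) iX iL iΓ iS iI
      (κ * μ ^ 2) (κ * μ ^ 2) (1 - r + κ * μ ^ 2) (κ + κ * μ ^ 2) (κ * μ ^ 2) 0
      fun ω => by linarith [(hb ω).2.2]
    obtain ⟨m1, m2, m3⟩ := moment_terms_le hκ hkg0 hkβ0 hkσ0 hμ.le hs0 (hV0 i) (hD0 i) hΓ0 hΓ
      (hS.trans (add_le_add_left
        (mul_le_mul_of_nonneg_left (b1.trans (le_of_eq (by ring))) hkβ0) _))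
    rw [hI] at b2
    constructor
    · change V (i + 1) ≤ _ at b2
      linarith
    · change D (i + 1) ≤ _ at b3
      linarith
  obtain ⟨K, θ, hK, hθ0, hθ1, hbound⟩ := hrec μ (σg ^ 2) V D hμ hμμ₀ hs0 hV0 hD0
    (fun i => (hstep i).1) (fun i => (hstep i).2)
  -- the disagreement is controlled by `D`
  have hdev : ∀ p i ω, w p i ω - centroid q w i ω = deviation q (shiftedModels wo w i ω) p := by
    intro p i ω
    have : shiftedModels wo w i ω = (fun p => w p i ω) - fun _ => wo := rfl
    rw [deviation, this, wsum_sub, wsum_const hq.sum_eq_one]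
    simp [centroid, wsum]
  have hdis0 : ∀ i, 0 ≤ disagreement Pr q w i := fun i =>
    mul_nonneg (by positivity) (Finset.sum_nonneg fun p _ => integral_nonneg fun ω => by positivity)
  have hdis : ∀ i, disagreement Pr q w i ≤ κ * C₁ * σg ^ 2 + κ * C₂ * μ + κ * K * θ ^ i := by
    intro i
    have h1 : ∑ p, ∫ ω, ‖w p i ω - centroid q w i ω‖ ^ 2 ∂Pr ≤ κ * D i := by
      simp only [hdev]
      rw [← integral_finsetSum _ fun p _ => (hy i p).norm.integrable_sq, hD, ← integral_const_mul]
      exact integral_mono (integrable_sqNorm (hy i))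
        ((integrable_lyapunov (hy i) q T k).const_mul κ) fun ω => hsq _
    -- for `P = 0` the quotient is `0`
    have h2 : (1 / (P : ℝ)) ≤ 1 := by
      rcases Nat.eq_zero_or_pos P with h | h
      · simp [h]
      · exact (div_le_one (by exact_mod_cast h)).2 (by exact_mod_cast h)
    have h3 : disagreement Pr q w i ≤ κ * D i := by
      refine le_trans ?_ h1
      exact mul_le_of_le_one_left
        (Finset.sum_nonneg fun p _ => integral_nonneg fun ω => by positivity) h2
    linarith [mul_le_mul_of_nonneg_left (hbound i) hκ.le]
  refine ⟨fun p i => ?_, ⟨κ * C₁ * σg ^ 2 + κ * C₂ * μ + κ * K, fun i => ?_⟩, ?_⟩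
  · simp only [hdev]
    exact hy i p
  · have := mul_le_of_le_one_right (mul_nonneg hκ.le hK) (pow_le_one₀ (n := i) hθ0 hθ1.le)
    linarith [hdis i]
  · exact limsup_le_of_le_add_geometric hdis0 hθ0 hθ1 hdis
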